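/- **Setting.** Let $\mathcal X$ be a finite nonempty data universe and $d=\log_2|\mathcal X|$. Let $\mathcal Q$ be a finite nonempty set of predicates $q:\mathcal X\to\{0,1\}$ that is closed under negation ($q\in\mathcal Q\Rightarrow 1-q\in\mathcal Q$), and let $S(\mathcal Q)$ be a separator set for $\mathcal Q$: a finite set of predicates $\tilde q:\mathcal X\to\{0,1\}$ such that any two distinct $x,x'\in\mathcal X$ satisfy $\tilde q(x)\ne\tilde q(x')$ for some $\tilde q\in S(\mathcal Q)$. Let $n\ge 1$ and $\rho>0$. For $D\in\mathcal X^n$ put $q(D)=\frac1n\sum_i q(D_i)$, and for a distribution $\widehat D$ on $\mathcal X$ put $q(\widehat D)=\mathbb E_{x\sim\widehat D}\,q(x)$. **Algorithm sepFEM$(T,\eta,s)$.** Draw $q_0\in\mathcal Q$ uniformly. In each round $t=1,\dots,T$: 1. The data player draws $s$ samples $x_1^t,\dots,x_s^t$, each with a fresh vector $\sigma_j$ of independent Laplace variables of scale $\eta$, where $$x_j^t\in\arg\max_{x\in\mathcal X}\Big\{\sum_{i=0}^{t-1}q_i(x)+\sum_{\tilde q\in S(\mathcal Q)}\sigma_{j,\tilde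 q}\,\tilde q(x)\Big\}$$ is computed by an arbitrary (measurable) exact optimization oracle. Let $\widehat D^t$ be the uniform distribution over these samples, counted with multiplicity. 2. The query player draws $q_t\in\mathcal Q$ with probability proportional to $\exp\!\big(\sqrt{2\rho/T}\;S_t(D,q)/(2\Delta)\big)$, where $S_t(D,q)=q(D)-q(\widehat D^t)$ and $\Delta$ is the sensitivity of $S_t$ under changing one entry of $D$ (if $\Delta=0$, $q_t$ is uniform). The output is $\widehat D=\frac1T\sum_{t=1}^T\widehat D^t$. **Theorem.** (a) (Privacy.) For all $T\ge1$, $\eta>0$, $s\ge1$ and $\delta\in(0,1)$, sepFEM is $(\varepsilon,\delta)$-differentially private (for datasets of size $n$ that differ in at most one entry) with $\varepsilon=\rho+2\sqrt{\rho\ln(1/\delta)}$. (b) (Accuracy.) There are an integer $k\ge 0$, an absolute constant $C_1$, and constants $C_2(\delta_0)$, $C_3(c,\delta_0,\beta_0)$ depending only on the displayed arguments, such that the following holds for all $\mathcal X,\mathcal Q,S(\mathcal Q),n,\rho$ as above, every oracle and every $\beta\in(0,1)$. There exist $T\ge1$, $\eta>0$, $s\ge1$, not depending on the dataset, such that for every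 $D\in\mathcal X^n$, with probability at least $1-\beta$, $$\max_{q\in\mathcal Q}|q(D)-q(\widehat D)|\le C_1\log^k\!\big(e+n+|S(\mathcal Q)|+d+\rho\big)\,\frac{|S(\mathcal Q)|^{3/8}d^{1/4}\sqrt{\log(|\mathcal Q|/\beta)}}{\rho^{1/4}n^{1/2}}.$$ For the same $T,\eta,s$: if $0<\delta\le\delta_0<1$ and $\varepsilon=\rho+2\sqrt{\rho\ln(1/\delta)}<1$, then with probability at least $1-\beta$ $$\max_{q\in\mathcal Q}|q(D)-q(\widehat D)|\le C_2(\delta_0)\log^k\!\big(e+n+|S(\mathcal Q)|+d\big)\,\frac{|S(\mathcal Q)|^{3/8}d^{1/4}\sqrt{\log(|\mathcal Q|/\beta)\log(1/\delta)}}{\varepsilon^{1/2}n^{1/2}}.$$ If moreover $|S(\mathcal Q)|\le c\,d$ and $\beta\le\beta_0<1$, then with probability at least $1-\beta$ $$\max_{q\in\mathcal Q}|q(D)-q(\widehat D)|\le C_3(c,\delta_0,\beta_0)\log^k(e+n+d)\,\frac{d^{5/8}\log^{1/2}|\mathcal Q|\,\log^{1/2}(1/\delta)\,\log^{1/2}(1/\beta)}{\varepsilon^{1/2}n^{1/2}}.$$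 -/

import Mathlib

open MeasureTheory
open scoped ENNReal

namespace QueryRelease

/-! Private query release over a finite data universe `X`. A predicate query is a map `X → Bool`,
read as a `{0,1}`-valued function through `Bool.toNat`; a query class is a finite set of such maps. -/

/-- The value `q(D)` of a statistical query on a dataset of `n` records. -/
noncomputable def answer {X : Type*} {n : ℕ} (q : X → Bool) (D : Fin n → X) : ℝ :=
  (∑ i, ((q (D i)).toNat : ℝ)) / n

/-- The value `q(w) = ∑ x, w(x) q(x)` of a query on a (weighted) synthetic database. -/
noncomputable def answerDist {X : Type*} [Fintype X] (q : X → Bool) (w : X → ℝ) : ℝ :=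
  ∑ x, w x * ((q x).toNat : ℝ)

/-- The weights of the uniform distribution over `x 0, …, x (s-1)`, counted with multiplicity. -/
noncomputable def empirical {X : Type*} [DecidableEq X] {s : ℕ} (x : Fin s → X) : X → ℝ :=
  fun y => ((Finset.univ.filter fun j => x j = y).card : ℝ) / s

/-- A query class is closed under negation. -/
def NegClosed {X : Type*} (Q : Finset (X → Bool)) : Prop :=
  ∀ q ∈ Q, (fun x => !(q x)) ∈ Q

/-- `S` is a separator set: any two distinct records are told apart by some predicate in `S`. -/
def IsSeparator {X : Type*} (S : Finset (X → Bool)) : Prop :=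
  ∀ x x' : X, x ≠ x' → ∃ q ∈ S, q x ≠ q x'

/-- Two datasets of the same size differ in at most one entry. -/
def Neighbor {X : Type*} {n : ℕ} (D D' : Fin n → X) : Prop :=
  {i | D i ≠ D' i}.ncard ≤ 1

/-- `(ε, δ)`-differential privacy of a randomized algorithm on datasets of size `n`. -/
def IsDP {X : Type*} {n : ℕ} {Y : Type*} (M : (Fin n → X) → PMF Y) (ε δ : ℝ) : Prop :=
  ∀ D D' : Fin n → X, Neighbor D D' → ∀ E : Set Y,
    (M D).toOuterMeasure E ≤
      ENNReal.ofReal (Real.exp ε) * (M D').toOuterMeasure E + ENNReal.ofReal δ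

/-- The sensitivity of a score function: its largest change between neighbouring datasets. -/
noncomputable def sensitivity {X : Type*} {n : ℕ} {R : Type*}
    (score : (Fin n → X) → R → ℝ) : ℝ :=
  sSup {v | ∃ D D' : Fin n → X, ∃ r : R, Neighbor D D' ∧ v = |score D r - score D' r|}

/-- The exponential mechanism: output `r` with probability proportional to
`exp (ε · score D r / (2 Δ))`, where `Δ` is the sensitivity of `score`. If `Δ = 0` the exponent is
`0` (division by zero in `ℝ`), and the output is uniform. -/
noncomputable def expMechanism {X : Type*} {n : ℕ} {R : Type*} [Fintype R] [Nonempty R]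
    (score : (Fin n → X) → R → ℝ) (ε : ℝ) (D : Fin n → X) : PMF R :=
  PMF.normalize
    (fun r => ENNReal.ofReal (Real.exp (ε * score D r / (2 * sensitivity score))))
    (by
      rw [tsum_fintype]
      have r : R := Classical.arbitrary R
      intro h
      rw [Finset.sum_eq_zero_iff] at h
      have := h r (Finset.mem_univ r)
      rw [ENNReal.ofReal_eq_zero] at this
      exact absurd this (not_le.2 (Real.exp_pos _)))
    (by
      rw [tsum_fintype]
      exact ENNReal.sum_ne_top.2 fun r _ => ENNReal.ofReal_ne_top)

/-- The Laplace distribution of scale `b > 0`, with density `exp (-|x| / b) / (2 b)`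
(for `b ≤ 0`, the point mass at `0`; only positive scales are used). -/
noncomputable def laplace (b : ℝ) : Measure ℝ :=
  if 0 < b then volume.withDensity fun x => ENNReal.ofReal (Real.exp (-|x| / b) / (2 * b))
  else Measure.dirac 0

instance isProbabilityMeasure_laplace (b : ℝ) : IsProbabilityMeasure (laplace b) := by
  unfold laplace
  split_ifs with hb
  · have h1 : ∫ x : ℝ, Real.exp (-|x| / b) / (2 * b) = 1 := by
      have h2 := integral_comp_abs (f := fun x : ℝ => Real.exp (-x / b) / (2 * b))
      have h3 : ∫ x in Set.Ioi (0 : ℝ), Real.exp (-x / b) / (2 * b) = 1 / 2 := by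
        rw [integral_div]
        have h4 : ∀ x : ℝ, Real.exp (-x / b) = Real.exp ((-(1 / b)) * x) := fun x => by
          congr 1; ring
        simp_rw [h4]
        rw [integral_exp_mul_Ioi (by simpa using hb)]
        simp
        field_simp
      rw [h2, h3]; norm_num
    have h5 : Integrable (fun x : ℝ => Real.exp (-|x| / b) / (2 * b)) :=
      integrable_of_integral_eq_one h1
    constructor
    rw [withDensity_apply _ MeasurableSet.univ, Measure.restrict_univ,
      ← ofReal_integral_eq_lintegral_ofReal h5 (Filter.Eventually.of_forall fun x => by positivity),
      h1, ENNReal.ofReal_one]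
  · infer_instance

/-- An optimization oracle: a (measurable) choice of a maximizer of each objective `f : X → ℝ`. -/
structure ArgmaxOracle (X : Type*) where
  /-- the chosen maximizer -/
  pick : (X → ℝ) → X
  le_pick : ∀ (f : X → ℝ) (x : X), f x ≤ f (pick f)
  measurableSet_pick : ∀ x : X, MeasurableSet {f : X → ℝ | pick f = x}

/-- Oracles exist: pick the first maximizer in an enumeration of `X`. -/
theorem nonempty_argmaxOracle (X : Type*) [Fintype X] [Nonempty X] :
    Nonempty (ArgmaxOracle X) := by
  classical
  let e := Fintype.equivFin X
  let A : (X → ℝ) → Finset (Fin (Fintype.card X)) := fun f =>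
    Finset.univ.filter fun i => ∀ y, f y ≤ f (e.symm i)
  have hA : ∀ f, (A f).Nonempty := fun f => by
    obtain ⟨x, hx⟩ := Finite.exists_max f
    exact ⟨e x, by simpa [A] using hx⟩
  refine ⟨⟨fun f => e.symm ((A f).min' (hA f)), fun f x => ?_, fun x => ?_⟩⟩
  · have h := (A f).min'_mem (hA f)
    exact (Finset.mem_filter.1 h).2 x
  · have hset : {f : X → ℝ | e.symm ((A f).min' (hA f)) = x} =
        {f | ∀ y, f y ≤ f x} ∩ {f | ∀ j, (∀ y, f y ≤ f (e.symm j)) → e x ≤ j} := by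
      ext f
      simp only [Set.mem_setOf_eq, Set.mem_inter_iff]
      constructor
      · rintro rfl
        refine ⟨(Finset.mem_filter.1 ((A f).min'_mem (hA f))).2, fun j hj => ?_⟩
        rw [Equiv.apply_symm_apply]
        exact Finset.min'_le _ _ (by simpa [A] using hj)
      · rintro ⟨h1, h2⟩
        rw [Equiv.symm_apply_eq]
        refine le_antisymm (Finset.min'_le _ _ (by simpa [A] using h1)) ?_
        exact h2 _ (Finset.mem_filter.1 ((A f).min'_mem (hA f))).2
    rw [hset]
    have hle : ∀ z : X, MeasurableSet {f : X → ℝ | ∀ y, f y ≤ f z} := fun z => by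
      rw [Set.setOf_forall]
      exact MeasurableSet.iInter fun y =>
        measurableSet_le (measurable_pi_apply y) (measurable_pi_apply z)
    refine (hle x).inter ?_
    rw [Set.setOf_forall]
    refine MeasurableSet.iInter fun j => ?_
    exact MeasurableSet.imp (hle _) (MeasurableSet.const _)

/-- The perturbed objective `∑ᵢ qᵢ(x) + ∑_{q̃ ∈ S} σ_{q̃} q̃(x)`. -/
noncomputable def objective {X : Type*} (S : Finset (X → Bool)) (qs : List (X → Bool))
    (σ : S → ℝ) (x : X) : ℝ :=
  (qs.map fun q => ((q x).toNat : ℝ)).sum + ∑ q : S, σ q * ((q.1 x).toNat : ℝ)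

theorem measurable_objective {X : Type*} (S : Finset (X → Bool)) (qs : List (X → Bool)) :
    Measurable (objective S qs) := by
  unfold objective
  fun_prop

/-- The law of one Separator-FTPL sample: the maximizer of the perturbed objective, where the
coordinates of the perturbation are independent Laplace variables of scale `η`. -/
noncomputable def ftpl {X : Type*} [Fintype X] (O : ArgmaxOracle X) (S : Finset (X → Bool))
    (η : ℝ) (qs : List (X → Bool)) : PMF X :=
  PMF.ofFintype
    (fun x => (Measure.pi fun _ : S => laplace η) {σ | O.pick (objective S qs σ) = x})
    (by
      have h := sum_measure_preimage_singleton (μ := Measure.pi fun _ : S => laplace η)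
        (Finset.univ : Finset X) (f := fun σ => O.pick (objective S qs σ))
        (fun x _ => (measurable_objective S qs) (O.measurableSet_pick x))
      simpa [Set.preimage] using h)

/-- The law of `s` independent samples from `p`. -/
noncomputable def iid {X : Type*} [Fintype X] (p : PMF X) (s : ℕ) : PMF (Fin s → X) :=
  PMF.ofFintype (fun x => ∏ j, p (x j)) (by
    have h1 : ∑ x, p x = 1 := by rw [← tsum_fintype (L := .unconditional X)]; exact p.tsum_coe
    classical
    rw [← Fintype.piFinset_univ, ← Finset.prod_univ_sum (fun _ => Finset.univ) fun _ x => p x]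
    simp [h1])

/-- The score function `S_t(D, q) = q(D) - q(D̂ᵗ)` of the query player, for the data player's batch
of samples `x` (so that `D̂ᵗ` is the uniform distribution over `x 0, …, x (s-1)`). -/
noncomputable def score {X : Type*} [Fintype X] [DecidableEq X] {n s : ℕ} (Q : Finset (X → Bool))
    (x : Fin s → X) (D : Fin n → X) (q : Q) : ℝ :=
  answer q.1 D - answerDist q.1 (empirical x)

/-- The transcript after `t` rounds: the queries `q_t, …, q_0` and the batches of the data player in
rounds `t, …, 1`. The query `q_0` is uniform; in each round the data player draws `s` fresh
Separator-FTPL samples against all earlier queries, and the query player then selects the next query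
with the exponential mechanism with privacy parameter `ε₀`. -/
noncomputable def transcript {X : Type*} [Fintype X] [DecidableEq X] {n : ℕ} (O : ArgmaxOracle X)
    (Q : Finset (X → Bool)) [Nonempty Q] (S : Finset (X → Bool)) (ε₀ η : ℝ) (s : ℕ)
    (D : Fin n → X) : ℕ → PMF (List Q × List (Fin s → X))
  | 0 => (PMF.uniformOfFintype Q).map fun q => ([q], [])
  | t + 1 =>
    (transcript O Q S ε₀ η s D t).bind fun h =>
      (iid (ftpl O S η (h.1.map Subtype.val)) s).bind fun x =>
        (expMechanism (score Q x) ε₀ D).map fun q => (q :: h.1, x :: h.2)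

/-- `sepFEM` with `T` rounds, noise scale `η`, `s` samples per round and privacy parameter `ρ`: the
law of the output `(1/T) ∑ₜ D̂ᵗ`. Each round runs the exponential mechanism with parameter
`√(2 ρ₀)`, where `ρ₀ = ρ / T`. -/
noncomputable def sepFEM {X : Type*} [Fintype X] [DecidableEq X] {n : ℕ} (O : ArgmaxOracle X)
    (Q : Finset (X → Bool)) [Nonempty Q] (S : Finset (X → Bool)) (ρ : ℝ) (T : ℕ) (η : ℝ) (s : ℕ)
    (D : Fin n → X) : PMF (X → ℝ) :=
  (transcript O Q S (Real.sqrt (2 * (ρ / T))) η s D T).map fun h =>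
    fun y => (h.2.map fun x => empirical x y).sum / T

/-- With probability at least `1 - β`, the output of `M` answers all queries in `Q` on the dataset
`D` with error at most `α`, that is, `max_{q ∈ Q} |q(D) - q(D̂)| ≤ α`. -/
def AccurateWithProb {X : Type*} [Fintype X] {n : ℕ} (M : (Fin n → X) → PMF (X → ℝ))
    (Q : Finset (X → Bool)) (D : Fin n → X) (α β : ℝ) : Prop :=
  ENNReal.ofReal (1 - β) ≤
    (M D).toOuterMeasure {w | ∀ q ∈ Q, |answer q D - answerDist q w| ≤ α}

/-- The dimension `d = log₂ |X|` of the data universe. -/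
noncomputable def dim (X : Type*) [Fintype X] : ℝ :=
  Real.logb 2 (Fintype.card X)

/-- The logarithmic factors hidden in `Õ`: `log(e + y)ᵏ`, with `y` the sum of the parameters. -/
noncomputable def polylog (k : ℕ) (y : ℝ) : ℝ :=
  Real.log (Real.exp 1 + y) ^ k

end QueryRelease

namespace QueryRelease

/-! ### Privacy -/

/-! Privacy. The data enter a round only through the exponential mechanism, whose output
probabilities on neighbouring datasets differ by factors at most `exp ε₀`, where `ε₀ = √(2ρ/T)`. By
convexity this bounds the Rényi moment of order `a` by `exp (a (a - 1) ε₀² / 2)` (`sum_rpow_le`).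
`HolderDom` states Rényi bounds in a dual form in which adaptive composition and post-processing are
immediate. After `T` rounds, `toOuterMeasure_le_of_holderDom` at the optimal order converts the
bound to `(ε, δ)`.

Accuracy. The algorithm is an approximate play of a zero-sum game. Averaged over the rounds,
near-optimality of each `q_t` bounds the error on every query by the mean of `q_t(D) - q_t(D̂ᵗ)`, up
to the selection error (`GoodHistory.sum_le`). Since `q(D)` is an average over records, this mean is
controlled by the regret of the data player against a single record (`regret_le`). That regret has
two parts: stability, where a shift of the Laplace noise along the separator set compensates one
extra query (`ftpl_cons_le`), and the size of the noise (`exists_noise_bound`). The regret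
inequality holds for every query sequence and the noise is fresh in each round, so adaptivity of the
queries does no harm; sampling error is handled by a union bound over `Q`. Closure under negation
turns one-sided errors into absolute ones.

With `M = |S|^(3/4) √d` and the best `η`, the average regret is of order `M / √T`, and the selection
error is of order `√T log(|Q|/β) / (√ρ n)` up to logarithms. Balancing the two in `T` gives the
rate; when the rate is at least 1 the claim is trivial. -/

theorem antitoneOn_cosh_mul_exp :
    AntitoneOn (fun x : ℝ => Real.cosh x * Real.exp (-(x ^ 2 / 2))) (Set.Ici 0) := by
  have hd : ∀ x : ℝ, HasDerivAt (fun x : ℝ => Real.cosh x * Real.exp (-(x ^ 2 / 2)))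
      ((Real.sinh x - x * Real.cosh x) * Real.exp (-(x ^ 2 / 2))) x := fun x => by
    have h1 : HasDerivAt (fun x : ℝ => -(x ^ 2 / 2)) (-x) x := by
      exact ((hasDerivAt_pow 2 x).div_const 2).neg.congr_deriv (by norm_num)
    exact ((Real.hasDerivAt_cosh x).mul h1.exp).congr_deriv (by ring)
  -- This function vanishes at 0 and has derivative `x sinh x ≥ 0`, so it is nonnegative, which is
  -- the sign needed for the derivative `hd`.
  have hmono : MonotoneOn (fun x : ℝ => x * Real.cosh x - Real.sinh x) (Set.Ici 0) := by
    have he : ∀ x : ℝ, HasDerivAt (fun x : ℝ => x * Real.cosh x - Real.sinh x)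
        (x * Real.sinh x) x := fun x => by
      exact (((hasDerivAt_id x).mul (Real.hasDerivAt_cosh x)).sub
        (Real.hasDerivAt_sinh x)).congr_deriv (by simp)
    refine monotoneOn_of_deriv_nonneg (convex_Ici 0)
      (fun x _ => (he x).continuousAt.continuousWithinAt)
      (fun x _ => (he x).differentiableAt.differentiableWithinAt) fun x hx => ?_
    rw [(he x).deriv]
    rw [interior_Ici] at hx
    exact mul_nonneg (le_of_lt hx) (Real.sinh_nonneg_iff.2 (le_of_lt hx))
  refine antitoneOn_of_deriv_nonpos (convex_Ici 0)
    (fun x _ => (hd x).continuousAt.continuousWithinAt)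
    (fun x _ => (hd x).differentiableAt.differentiableWithinAt) fun x hx => ?_
  rw [(hd x).deriv]
  rw [interior_Ici] at hx
  have h := hmono (Set.mem_Ici.2 le_rfl) (Set.mem_Ici.2 (le_of_lt hx)) (le_of_lt hx)
  simp only [zero_mul, Real.sinh_zero, sub_zero] at h
  exact mul_nonpos_of_nonpos_of_nonneg (by linarith) (Real.exp_pos _).le

theorem cosh_le_cosh_mul_exp {u v : ℝ} (hv : 0 ≤ v) (hvu : v ≤ u) :
    Real.cosh u ≤ Real.cosh v * Real.exp ((u ^ 2 - v ^ 2) / 2) := by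
  have h := antitoneOn_cosh_mul_exp (Set.mem_Ici.2 hv) (Set.mem_Ici.2 (hv.trans hvu)) hvu
  have h2 := mul_le_mul_of_nonneg_right h (Real.exp_pos (u ^ 2 / 2)).le
  simp only [mul_assoc, ← Real.exp_add] at h2
  rw [neg_add_cancel, Real.exp_zero, mul_one] at h2
  refine h2.trans (le_of_eq ?_)
  congr 2
  ring

/-- The value at `1` of the chord of `r ↦ r ^ a` on `[exp (-ε), exp ε]`. -/
theorem chord_le {a ε : ℝ} (ha : 1 ≤ a) (hε : 0 < ε) :
    (1 - Real.exp (-ε)) * Real.exp (a * ε) + (Real.exp ε - 1) * Real.exp (-(a * ε)) ≤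
      Real.exp (a * (a - 1) * ε ^ 2 / 2) * (Real.exp ε - Real.exp (-ε)) := by
  -- Here `(u² - v²) / 2` is the desired exponent, and multiplying by `4 sinh (ε / 2)` turns the two
  -- hyperbolic cosines into the two sides of the claim.
  have h := cosh_le_cosh_mul_exp (u := (a - 1 / 2) * ε) (v := ε / 2) (by positivity)
    (by nlinarith)
  have e1 : (((a - 1 / 2) * ε) ^ 2 - (ε / 2) ^ 2) / 2 = a * (a - 1) * ε ^ 2 / 2 := by ring
  rw [e1] at h
  rw [Real.cosh_eq, Real.cosh_eq] at h
  have hs : 0 < Real.exp (ε / 2) - Real.exp (-(ε / 2)) := by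
    rw [sub_pos]; exact Real.exp_lt_exp.2 (by linarith)
  have h2 := mul_le_mul_of_nonneg_right h hs.le
  have e2 : (1 - Real.exp (-ε)) * Real.exp (a * ε) + (Real.exp ε - 1) * Real.exp (-(a * ε)) =
      2 * ((Real.exp ((a - 1 / 2) * ε) + Real.exp (-((a - 1 / 2) * ε))) / 2 *
        (Real.exp (ε / 2) - Real.exp (-(ε / 2)))) := by
    have : ∀ x y z w : ℝ, 2 * ((x + y) / 2 * (z - w)) = x * z - x * w + y * z - y * w := by
      intros; ring
    rw [this, sub_mul, sub_mul]
    simp only [← Real.exp_add, one_mul]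
    have h1 : (a - 1 / 2) * ε + ε / 2 = a * ε := by ring
    have h2 : (a - 1 / 2) * ε + -(ε / 2) = -ε + a * ε := by ring
    have h3 : -((a - 1 / 2) * ε) + ε / 2 = ε + -(a * ε) := by ring
    have h4 : -((a - 1 / 2) * ε) + -(ε / 2) = -(a * ε) := by ring
    rw [h1, h2, h3, h4]; ring
  have e3 : (Real.exp (ε / 2) + Real.exp (-(ε / 2))) * (Real.exp (ε / 2) - Real.exp (-(ε / 2))) =
      Real.exp ε - Real.exp (-ε) := by
    have : ∀ z w : ℝ, (z + w) * (z - w) = z * z - w * w := by intros; ring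
    rw [this, ← Real.exp_add, ← Real.exp_add]
    congr 2 <;> ring
  rw [e2, ← e3]
  linarith

/-- Convexity of `r ↦ r ^ a`, with the length of the interval cleared from the denominator. -/
theorem rpow_le_chord {a ε r : ℝ} (ha : 1 ≤ a) (hε : 0 < ε) (h1 : Real.exp (-ε) ≤ r)
    (h2 : r ≤ Real.exp ε) :
    r ^ a * (Real.exp ε - Real.exp (-ε)) ≤
      (r - Real.exp (-ε)) * Real.exp (a * ε) + (Real.exp ε - r) * Real.exp (-(a * ε)) := by
  have hs : 0 < Real.exp ε - Real.exp (-ε) := by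
    rw [sub_pos]; exact Real.exp_lt_exp.2 (by linarith)
  have h := (convexOn_rpow ha).2 (Set.mem_Ici.2 (Real.exp_pos ε).le)
    (Set.mem_Ici.2 (Real.exp_pos (-ε)).le)
    (div_nonneg (sub_nonneg.2 h1) hs.le) (div_nonneg (sub_nonneg.2 h2) hs.le)
    (by field_simp; ring)
  have e : (r - Real.exp (-ε)) / (Real.exp ε - Real.exp (-ε)) * Real.exp ε +
      (Real.exp ε - r) / (Real.exp ε - Real.exp (-ε)) * Real.exp (-ε) = r := by
    field_simp; ring
  simp only [smul_eq_mul, e, ← Real.exp_mul] at h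
  have h3 := mul_le_mul_of_nonneg_right h hs.le
  refine h3.trans (le_of_eq ?_)
  rw [mul_comm ε a, neg_mul, mul_comm ε a]
  field_simp

/-- `(ε, 0)`-indistinguishable distributions have Rényi moments at most
`exp (a (a - 1) ε² / 2)`. -/
theorem sum_rpow_le {R : Type*} [Fintype R] {p q : R → ℝ} {a ε : ℝ} (ha : 1 ≤ a) (hε : 0 < ε)
    (hq : ∀ r, 0 < q r) (hp1 : ∑ r, p r = 1) (hq1 : ∑ r, q r = 1)
    (h1 : ∀ r, p r ≤ Real.exp ε * q r) (h2 : ∀ r, q r ≤ Real.exp ε * p r) :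
    ∑ r, q r * (p r / q r) ^ a ≤ Real.exp (a * (a - 1) * ε ^ 2 / 2) := by
  have hs : 0 < Real.exp ε - Real.exp (-ε) := by
    rw [sub_pos]; exact Real.exp_lt_exp.2 (by linarith)
  refine le_of_mul_le_mul_right ?_ hs
  refine le_trans ?_ (chord_le ha hε)
  rw [Finset.sum_mul]
  -- The chord is affine in the ratio `p r / q r`, so averaging under `q` amounts to evaluating it
  -- at the mean ratio 1.
  calc ∑ r, q r * (p r / q r) ^ a * (Real.exp ε - Real.exp (-ε))
      ≤ ∑ r, ((p r - q r * Real.exp (-ε)) * Real.exp (a * ε) +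
          (q r * Real.exp ε - p r) * Real.exp (-(a * ε))) := by
        refine Finset.sum_le_sum fun r _ => ?_
        have hr := rpow_le_chord (r := p r / q r) ha hε
          (by rw [le_div_iff₀ (hq r), Real.exp_neg, inv_mul_le_iff₀ (Real.exp_pos _)]; exact h2 r)
          (by rw [div_le_iff₀ (hq r)]; exact h1 r)
        have := mul_le_mul_of_nonneg_left hr (hq r).le
        rw [mul_assoc]
        refine this.trans (le_of_eq ?_)
        have hne := (hq r).ne'
        field_simp
    _ = _ := by
        simp only [Finset.sum_add_distrib, ← Finset.sum_mul, Finset.sum_sub_distrib, hp1, hq1]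
        ring

/-! ### Rényi divergence in dual form: composition and conversion. -/

/-- `P` is dominated by `Q` in the dual form of a bound on the Rényi divergence: the expectation of
`f` under `P` is at most `C` times the `L^b`-norm of `f` under `Q`. -/
def HolderDom {Y : Type*} (b : ℝ) (C : ℝ≥0∞) (P Q : PMF Y) : Prop :=
  ∀ f : Y → ℝ≥0∞, ∑' y, P y * f y ≤ C * (∑' y, Q y * f y ^ b) ^ (1 / b)

theorem tsum_bind_mul {Y Z : Type*} (P : PMF Y) (k : Y → PMF Z) (f : Z → ℝ≥0∞) :
    ∑' z, P.bind k z * f z = ∑' y, P y * ∑' z, k y z * f z := by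
  simp only [PMF.bind_apply, ← ENNReal.tsum_mul_right, ← ENNReal.tsum_mul_left]
  rw [ENNReal.tsum_comm]
  simp only [mul_assoc]

theorem tsum_pure_mul {Z : Type*} (z : Z) (f : Z → ℝ≥0∞) : ∑' y, PMF.pure z y * f y = f z := by
  rw [tsum_eq_single z]
  · simp
  · intro y hy
    simp [hy]

/-- Hölder's inequality for the splitting `P y = P y ^ (1 / a) * P y ^ (1 / b)`, using that `P` has
mass 1. -/
theorem HolderDom.refl {Y : Type*} {b : ℝ} (hb : 1 ≤ b) (P : PMF Y) : HolderDom b 1 P P := by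
  intro f
  rw [one_mul]
  rcases hb.eq_or_lt with rfl | hb'
  · simp
  have hb0 : 0 < b := by linarith
  obtain ⟨a, hab⟩ : ∃ a : ℝ, a.HolderConjugate b :=
    ⟨b.conjExponent, (Real.HolderConjugate.conjExponent hb').symm⟩
  have key : ∀ s : Finset Y, (∑ y ∈ s, P y * f y) ≤ (∑' y, P y * f y ^ b) ^ (1 / b) := by
    intro s
    have h := ENNReal.inner_le_Lp_mul_Lq s (fun y => P y ^ (1 / a)) (fun y => P y ^ (1 / b) * f y)
      hab
    have e : ∀ y, P y ^ (1 / a) * (P y ^ (1 / b) * f y) = P y * f y := fun y => by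
      rw [← mul_assoc, ← ENNReal.rpow_add_of_nonneg _ _ (by have := hab.pos; positivity)
        (by positivity), one_div, one_div, hab.inv_add_inv_eq_one, ENNReal.rpow_one]
    simp only [e] at h
    refine h.trans ?_
    have e2 : ∀ y, (P y ^ (1 / a)) ^ a = P y := fun y => by
      rw [← ENNReal.rpow_mul, one_div_mul_cancel hab.ne_zero, ENNReal.rpow_one]
    have e3 : ∀ y, (P y ^ (1 / b) * f y) ^ b = P y * f y ^ b := fun y => by
      rw [ENNReal.mul_rpow_of_nonneg _ _ hb0.le, ← ENNReal.rpow_mul, one_div_mul_cancel hb0.ne',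
        ENNReal.rpow_one]
    simp only [e2, e3]
    calc _ ≤ 1 ^ (1 / a) * (∑' y, P y * f y ^ b) ^ (1 / b) := by
          have := hab.pos
          gcongr
          · exact (ENNReal.sum_le_tsum s).trans P.tsum_coe.le
          · exact ENNReal.sum_le_tsum s
      _ = _ := by simp
  rw [ENNReal.tsum_eq_iSup_sum]
  exact iSup_le key

/-- Adaptive composition. The bound for the kernels produces the `L^b`-norm of `f` under `k' y`.
Taken as a test function of `y` in the bound for `P` and `Q`, its powers `1 / b` and `b` cancel, so
the constants multiply. -/
theorem HolderDom.bind {Y Z : Type*} {b : ℝ} (hb : 1 ≤ b) {C₁ C₂ : ℝ≥0∞} {P Q : PMF Y}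
    {k k' : Y → PMF Z} (h : HolderDom b C₁ P Q) (hk : ∀ y, HolderDom b C₂ (k y) (k' y)) :
    HolderDom b (C₁ * C₂) (P.bind k) (Q.bind k') := by
  intro f
  rw [tsum_bind_mul, tsum_bind_mul]
  calc ∑' y, P y * ∑' z, k y z * f z
      ≤ ∑' y, P y * (C₂ * (∑' z, k' y z * f z ^ b) ^ (1 / b)) :=
        ENNReal.tsum_le_tsum fun y => by gcongr; exact hk y f
    _ = C₂ * ∑' y, P y * (∑' z, k' y z * f z ^ b) ^ (1 / b) := by
        rw [← ENNReal.tsum_mul_left]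
        exact tsum_congr fun y => by ring
    _ ≤ C₂ * (C₁ * (∑' y, Q y * ((∑' z, k' y z * f z ^ b) ^ (1 / b)) ^ b) ^ (1 / b)) := by
        gcongr
        exact h _
    _ = _ := by
        simp only [← ENNReal.rpow_mul, one_div_mul_cancel (show b ≠ 0 by linarith),
          ENNReal.rpow_one]
        ring

theorem HolderDom.map {Y Z : Type*} {b : ℝ} {C : ℝ≥0∞} {P Q : PMF Y} (g : Y → Z)
    (h : HolderDom b C P Q) : HolderDom b C (P.map g) (Q.map g) := by
  intro f
  have := h (f ∘ g)
  simpa only [PMF.map, tsum_bind_mul, Function.comp_apply, tsum_pure_mul] using this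

/-- Hölder applied to `Q^(1/a) (P/Q)` and `Q^(1/b) f`. The first factor contributes the `a`-th root
of the Rényi moment, which removes one factor `a` from the exponent. -/
theorem holderDom_of_le {R : Type*} [Fintype R] {P Q : PMF R} {a b ε : ℝ}
    (hab : a.HolderConjugate b) (hε : 0 < ε) (hQ : ∀ r, Q r ≠ 0)
    (h1 : ∀ r, P r ≤ ENNReal.ofReal (Real.exp ε) * Q r)
    (h2 : ∀ r, Q r ≤ ENNReal.ofReal (Real.exp ε) * P r) :
    HolderDom b (ENNReal.ofReal (Real.exp ((a - 1) * ε ^ 2 / 2))) P Q := by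
  intro f
  rw [tsum_fintype, tsum_fintype]
  have hP1 : ∑ r, (P r).toReal = 1 := by
    rw [← ENNReal.toReal_sum fun r _ => P.apply_ne_top r,
      ← tsum_fintype (L := .unconditional R), P.tsum_coe, ENNReal.toReal_one]
  have hQ1 : ∑ r, (Q r).toReal = 1 := by
    rw [← ENNReal.toReal_sum fun r _ => Q.apply_ne_top r,
      ← tsum_fintype (L := .unconditional R), Q.tsum_coe, ENNReal.toReal_one]
  have conv : ∀ {x y : ℝ≥0∞}, y ≠ ⊤ → x ≤ ENNReal.ofReal (Real.exp ε) * y →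
      x.toReal ≤ Real.exp ε * y.toReal := fun {x y} hy h => by
    have := ENNReal.toReal_mono (ENNReal.mul_ne_top ENNReal.ofReal_ne_top hy) h
    rwa [ENNReal.toReal_mul, ENNReal.toReal_ofReal (Real.exp_pos _).le] at this
  have hQpos : ∀ r, 0 < (Q r).toReal := fun r => ENNReal.toReal_pos (hQ r) (Q.apply_ne_top r)
  have hmom := sum_rpow_le (p := fun r => (P r).toReal) (q := fun r => (Q r).toReal)
    hab.lt.le hε hQpos hP1 hQ1 (fun r => conv (Q.apply_ne_top r) (h1 r))
    (fun r => conv (P.apply_ne_top r) (h2 r))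
  have hmom' : ∑ r, Q r * (P r / Q r) ^ a ≤
      ENNReal.ofReal (Real.exp (a * (a - 1) * ε ^ 2 / 2)) := by
    refine le_trans (le_of_eq ?_) (ENNReal.ofReal_le_ofReal hmom)
    rw [ENNReal.ofReal_sum_of_nonneg fun r _ => by positivity]
    refine Finset.sum_congr rfl fun r _ => ?_
    rw [ENNReal.ofReal_mul (hQpos r).le, ENNReal.ofReal_toReal (Q.apply_ne_top r),
      ← ENNReal.ofReal_rpow_of_nonneg (by positivity) hab.pos.le,
      ENNReal.ofReal_div_of_pos (hQpos r), ENNReal.ofReal_toReal (Q.apply_ne_top r),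
      ENNReal.ofReal_toReal (P.apply_ne_top r)]
  have h := ENNReal.inner_le_Lp_mul_Lq Finset.univ (fun r => Q r ^ (1 / a) * (P r / Q r))
    (fun r => Q r ^ (1 / b) * f r) hab
  have e : ∀ r, Q r ^ (1 / a) * (P r / Q r) * (Q r ^ (1 / b) * f r) = P r * f r := fun r => by
    have h0 : Q r ^ (1 / a) * Q r ^ (1 / b) = Q r := by
      rw [← ENNReal.rpow_add_of_nonneg _ _ (by have := hab.pos; positivity)
        (by have := hab.symm.pos; positivity), one_div, one_div, hab.inv_add_inv_eq_one,
        ENNReal.rpow_one]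
    calc _ = Q r ^ (1 / a) * Q r ^ (1 / b) * (P r / Q r) * f r := by ring
      _ = _ := by rw [h0, ENNReal.mul_div_cancel (hQ r) (Q.apply_ne_top r)]
  have e2 : ∀ r, (Q r ^ (1 / a) * (P r / Q r)) ^ a = Q r * (P r / Q r) ^ a := fun r => by
    rw [ENNReal.mul_rpow_of_nonneg _ _ hab.pos.le, ← ENNReal.rpow_mul,
      one_div_mul_cancel hab.ne_zero, ENNReal.rpow_one]
  have e3 : ∀ r, (Q r ^ (1 / b) * f r) ^ b = Q r * f r ^ b := fun r => by
    rw [ENNReal.mul_rpow_of_nonneg _ _ hab.symm.pos.le, ← ENNReal.rpow_mul,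
      one_div_mul_cancel hab.symm.ne_zero, ENNReal.rpow_one]
  simp only [e, e2, e3] at h
  refine h.trans ?_
  gcongr
  have := hab.pos
  calc (∑ r, Q r * (P r / Q r) ^ a) ^ (1 / a)
      ≤ ENNReal.ofReal (Real.exp (a * (a - 1) * ε ^ 2 / 2)) ^ (1 / a) := by gcongr
    _ = _ := by
      rw [ENNReal.ofReal_rpow_of_pos (Real.exp_pos _), ← Real.exp_mul]
      congr 2
      field_simp

/-- Conversion of a Rényi divergence bound to approximate indistinguishability. -/
theorem toOuterMeasure_le_of_holderDom {Y : Type*} {P Q : PMF Y} {a b c ε : ℝ}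
    (hab : a.HolderConjugate b)
    (h : HolderDom b (ENNReal.ofReal (Real.exp c)) P Q) (E : Set Y) :
    P.toOuterMeasure E ≤ ENNReal.ofReal (Real.exp ε) * Q.toOuterMeasure E +
      ENNReal.ofReal (Real.exp (a * c - (a - 1) * ε)) := by
  classical
  set e := ENNReal.ofReal (Real.exp ε) with he
  have he0 : e ≠ 0 := by simp [he, Real.exp_pos]
  have het : e ≠ ⊤ := ENNReal.ofReal_ne_top
  -- Outside `B` the multiplicative bound holds pointwise, so the additive error is at most `P(B)`.
  set B : Set Y := {y | e * Q y < P y} with hB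
  have hb0 := hab.symm.pos
  have ha0 := hab.pos
  have h1 : P.toOuterMeasure E ≤ e * Q.toOuterMeasure E + P.toOuterMeasure B := by
    simp only [PMF.toOuterMeasure_apply]
    rw [← ENNReal.tsum_mul_left, ← ENNReal.tsum_add]
    refine ENNReal.tsum_le_tsum fun y => ?_
    by_cases hyE : y ∈ E
    · by_cases hyB : y ∈ B
      · simp [hyE, hyB]
      · simpa [hyE, hyB] using not_lt.1 hyB
    · simp [hyE]
  refine h1.trans ?_
  gcongr
  have h2 : e * Q.toOuterMeasure B ≤ P.toOuterMeasure B := by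
    simp only [PMF.toOuterMeasure_apply]
    rw [← ENNReal.tsum_mul_left]
    refine ENNReal.tsum_le_tsum fun y => ?_
    by_cases hyB : y ∈ B
    · simpa [hyB] using le_of_lt hyB
    · simp [hyB]
  have h3 : P.toOuterMeasure B ≤
      ENNReal.ofReal (Real.exp c) * Q.toOuterMeasure B ^ (1 / b) := by
    have := h (B.indicator 1)
    convert this using 2
    · rw [PMF.toOuterMeasure_apply]
      exact tsum_congr fun y => by by_cases hy : y ∈ B <;> simp [hy]
    · rw [PMF.toOuterMeasure_apply]
      congr 1
      exact tsum_congr fun y => by by_cases hy : y ∈ B <;> simp [hy, hb0]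
  set u := P.toOuterMeasure B
  have hu1 : u ≤ 1 := (P.toOuterMeasure.mono (Set.subset_univ B)).trans (by
    simp [PMF.toOuterMeasure_apply, P.tsum_coe])
  have hut : u ≠ ⊤ := ne_top_of_le_ne_top ENNReal.one_ne_top hu1
  by_cases hu0 : u = 0
  · rw [hu0]; exact zero_le
  have h4 : Q.toOuterMeasure B ≤ ENNReal.ofReal (Real.exp (-ε)) * u := by
    have := mul_le_mul_right h2 (ENNReal.ofReal (Real.exp (-ε)))
    rwa [← mul_assoc, he, ← ENNReal.ofReal_mul (Real.exp_pos _).le, ← Real.exp_add,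
      neg_add_cancel, Real.exp_zero, ENNReal.ofReal_one, one_mul] at this
  lift u to NNReal using hut with v hv
  -- Inserting `Q(B) ≤ exp (-ε) P(B)` gives an inequality with `P(B)` on both sides and exponent `1
  -- / b < 1` on the right; taking logarithms solves it for `P(B)`.
  have h5 : (v : ℝ) ≤ Real.exp c * (Real.exp (-ε) * v) ^ (1 / b) := by
    have : (v : ℝ≥0∞) ≤ ENNReal.ofReal (Real.exp c) *
        (ENNReal.ofReal (Real.exp (-ε)) * v) ^ (1 / b) := by
      refine h3.trans ?_
      gcongr
    rw [← ENNReal.ofReal_coe_nnreal, ← ENNReal.ofReal_mul (Real.exp_pos _).le,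
      ENNReal.ofReal_rpow_of_nonneg (by positivity) (by positivity),
      ← ENNReal.ofReal_mul (Real.exp_pos _).le] at this
    exact (ENNReal.ofReal_le_ofReal_iff (by positivity)).1 this
  rw [← ENNReal.ofReal_coe_nnreal]
  refine ENNReal.ofReal_le_ofReal ?_
  have hv0 : (0 : ℝ) < v := by
    have : v ≠ 0 := by simpa using hu0
    positivity
  have h6 := Real.log_le_log hv0 h5
  rw [Real.log_mul (by positivity) (by positivity), Real.log_exp,
    Real.log_rpow (by positivity), Real.log_mul (by positivity) (by positivity), Real.log_exp] at h6
  rw [← Real.log_le_iff_le_exp hv0]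
  have hb1 : 1 / b = 1 - 1 / a := by
    have := hab.inv_add_inv_eq_one
    simp only [one_div]; linarith
  rw [hb1] at h6
  have h7 := mul_le_mul_of_nonneg_left h6 ha0.le
  have e1 : a * (c + (1 - 1 / a) * (-ε + Real.log v)) =
    a * c + (a - 1) * (-ε) + (a - 1) * Real.log v := by field_simp; ring
  rw [e1] at h7
  linarith

/-! ### Sensitivity of the score and privacy of the exponential mechanism. -/

theorem Neighbor.symm {X : Type*} {n : ℕ} {D D' : Fin n → X} (h : Neighbor D D') :
    Neighbor D' D := by
  unfold Neighbor at *
  simpa only [ne_comm] using h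

theorem abs_toNat_sub_le (b c : Bool) : |((b.toNat : ℝ)) - (c.toNat : ℝ)| ≤ 1 := by
  cases b <;> cases c <;> simp

theorem abs_answer_sub_le {X : Type*} {n : ℕ} (q : X → Bool) {D D' : Fin n → X}
    (h : Neighbor D D') : |answer q D - answer q D'| ≤ 1 / n := by
  classical
  unfold answer
  rw [← sub_div, abs_div, Nat.abs_cast, ← Finset.sum_sub_distrib]
  gcongr
  calc |∑ i, (((q (D i)).toNat : ℝ) - ((q (D' i)).toNat : ℝ))|
      ≤ ∑ i, |((q (D i)).toNat : ℝ) - ((q (D' i)).toNat : ℝ)| := Finset.abs_sum_le_sum_abs _ _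
    _ ≤ ∑ i, if D i ≠ D' i then (1 : ℝ) else 0 := by
        refine Finset.sum_le_sum fun i _ => ?_
        split_ifs with hi
        · exact abs_toNat_sub_le _ _
        · rw [not_ne_iff.1 hi]; simp
    _ ≤ 1 := by
        rw [Finset.sum_boole]
        unfold Neighbor at h
        rw [Set.ncard_eq_toFinset_card'] at h
        refine le_trans (le_of_eq ?_) (Nat.cast_le_one.2 h)
        congr 2
        ext i
        simp

theorem score_sub_score {X : Type*} [Fintype X] [DecidableEq X] {n s : ℕ} {Q : Finset (X → Bool)}
    (x : Fin s → X) (D D' : Fin n → X) (q : Q) :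
    score Q x D q - score Q x D' q = answer q.1 D - answer q.1 D' := by
  unfold score
  ring

theorem bddAbove_score {X : Type*} [Fintype X] [DecidableEq X] {n s : ℕ} (Q : Finset (X → Bool))
    (x : Fin s → X) :
    BddAbove {v | ∃ D D' : Fin n → X, ∃ r : Q, Neighbor D D' ∧
      v = |score Q x D r - score Q x D' r|} := by
  refine ⟨1 / n, ?_⟩
  rintro v ⟨D, D', r, h, rfl⟩
  rw [score_sub_score]
  exact abs_answer_sub_le _ h

theorem abs_score_sub_le {X : Type*} [Fintype X] [DecidableEq X] {n s : ℕ} (Q : Finset (X → Bool))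
    (x : Fin s → X) {D D' : Fin n → X} (h : Neighbor D D') (r : Q) :
    |score Q x D r - score Q x D' r| ≤ sensitivity (score (n := n) Q x) :=
  le_csSup (bddAbove_score Q x) ⟨D, D', r, h, rfl⟩

/-- The unnormalized weights of the exponential mechanism. -/
noncomputable def expWeight {X : Type*} {n : ℕ} {R : Type*} (score : (Fin n → X) → R → ℝ) (ε : ℝ)
    (D : Fin n → X) (r : R) : ℝ≥0∞ :=
  ENNReal.ofReal (Real.exp (ε * score D r / (2 * sensitivity score)))

theorem expMechanism_apply {X : Type*} {n : ℕ} {R : Type*} [Fintype R] [Nonempty R]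
    (score : (Fin n → X) → R → ℝ) (ε : ℝ) (D : Fin n → X) (r : R) :
    expMechanism score ε D r = expWeight score ε D r * (∑ r, expWeight score ε D r)⁻¹ := by
  unfold expMechanism
  rw [PMF.normalize_apply, tsum_fintype]
  rfl

theorem expWeight_ne_zero {X : Type*} {n : ℕ} {R : Type*} (score : (Fin n → X) → R → ℝ) (ε : ℝ)
    (D : Fin n → X) (r : R) : expWeight score ε D r ≠ 0 := by
  simp [expWeight, Real.exp_pos]

theorem sum_expWeight_ne_top {X : Type*} {n : ℕ} {R : Type*} [Fintype R]
    (score : (Fin n → X) → R → ℝ) (ε : ℝ)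
    (D : Fin n → X) : ∑ r, expWeight score ε D r ≠ ⊤ :=
  ENNReal.sum_ne_top.2 fun _ _ => ENNReal.ofReal_ne_top

theorem expMechanism_ne_zero {X : Type*} {n : ℕ} {R : Type*} [Fintype R] [Nonempty R]
    (score : (Fin n → X) → R → ℝ) (ε : ℝ) (D : Fin n → X) (r : R) :
    expMechanism score ε D r ≠ 0 := by
  rw [expMechanism_apply]
  exact mul_ne_zero (expWeight_ne_zero _ _ _ _)
    (ENNReal.inv_ne_zero.2 (sum_expWeight_ne_top _ _ _))

/-- The weight and the normalizer each change by at most a factor `exp (ε / 2)`. -/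
theorem expMechanism_le {X : Type*} {n : ℕ} {R : Type*} [Fintype R] [Nonempty R]
    {score : (Fin n → X) → R → ℝ} {ε : ℝ} (hε : 0 ≤ ε) {D D' : Fin n → X}
    (h : ∀ r, |score D r - score D' r| ≤ sensitivity score) (r : R) :
    expMechanism score ε D r ≤ ENNReal.ofReal (Real.exp ε) * expMechanism score ε D' r := by
  have key : ∀ {D D' : Fin n → X}, (∀ r, |score D r - score D' r| ≤ sensitivity score) →
      ∀ r, expWeight score ε D r ≤
        ENNReal.ofReal (Real.exp (ε / 2)) * expWeight score ε D' r := by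
    intro D D' h r
    unfold expWeight
    rw [← ENNReal.ofReal_mul (Real.exp_pos _).le, ← Real.exp_add]
    refine ENNReal.ofReal_le_ofReal (Real.exp_le_exp.2 ?_)
    have h0 : 0 ≤ sensitivity score := (abs_nonneg _).trans (h r)
    -- At zero sensitivity both exponents are 0 by division by zero.
    rcases h0.eq_or_lt with h0 | h0
    · rw [← h0]; simp; positivity
    · rw [← sub_le_iff_le_add, ← sub_div, ← mul_sub, div_le_iff₀ (by positivity)]
      have := mul_le_mul_of_nonneg_left ((le_abs_self _).trans (h r)) hε
      linarith
  rw [expMechanism_apply, expMechanism_apply]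
  have hsum : ∑ r, expWeight score ε D' r ≤
      ENNReal.ofReal (Real.exp (ε / 2)) * ∑ r, expWeight score ε D r := by
    rw [Finset.mul_sum]
    exact Finset.sum_le_sum fun r _ => key (fun r => by rw [abs_sub_comm]; exact h r) r
  have he0 : ENNReal.ofReal (Real.exp (ε / 2)) ≠ 0 := by simp [Real.exp_pos]
  have hinv : (∑ r, expWeight score ε D r)⁻¹ ≤
      ENNReal.ofReal (Real.exp (ε / 2)) * (∑ r, expWeight score ε D' r)⁻¹ := by
    have h1 := ENNReal.inv_le_inv.2 hsum
    rw [ENNReal.mul_inv (Or.inl he0) (Or.inl ENNReal.ofReal_ne_top)] at h1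
    have h2 := mul_le_mul_right h1 (ENNReal.ofReal (Real.exp (ε / 2)))
    rwa [← mul_assoc, ENNReal.mul_inv_cancel he0 ENNReal.ofReal_ne_top, one_mul] at h2
  calc _ ≤ (ENNReal.ofReal (Real.exp (ε / 2)) * expWeight score ε D' r) *
        (ENNReal.ofReal (Real.exp (ε / 2)) * (∑ r, expWeight score ε D' r)⁻¹) :=
        mul_le_mul' (key h r) hinv
    _ = _ := by
        rw [mul_mul_mul_comm, ← ENNReal.ofReal_mul (Real.exp_pos _).le, ← Real.exp_add, add_halves]

/-- Given the history, the batch has the same law for both datasets and costs a factor 1; only the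
query selection contributes in each round. -/
theorem holderDom_transcript {X : Type*} [Fintype X] [DecidableEq X] {n : ℕ} (O : ArgmaxOracle X)
    (Q : Finset (X → Bool)) [Nonempty Q] (S : Finset (X → Bool)) {ε₀ : ℝ} (hε₀ : 0 < ε₀) (η : ℝ)
    (s : ℕ) {D D' : Fin n → X} (h : Neighbor D D') {a b : ℝ} (hab : a.HolderConjugate b) (t : ℕ) :
    HolderDom b (ENNReal.ofReal (Real.exp (t * ((a - 1) * ε₀ ^ 2 / 2))))
      (transcript O Q S ε₀ η s D t) (transcript O Q S ε₀ η s D' t) := by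
  have hb : 1 ≤ b := hab.symm.lt.le
  induction t with
  | zero => simpa [transcript] using HolderDom.refl hb _
  | succ t ih =>
    have e : ENNReal.ofReal (Real.exp ((t + 1 : ℕ) * ((a - 1) * ε₀ ^ 2 / 2))) =
        ENNReal.ofReal (Real.exp (t * ((a - 1) * ε₀ ^ 2 / 2))) *
          (1 * ENNReal.ofReal (Real.exp ((a - 1) * ε₀ ^ 2 / 2))) := by
      rw [one_mul, ← ENNReal.ofReal_mul (Real.exp_pos _).le, ← Real.exp_add]
      congr 2
      push_cast
      ring
    rw [e]
    refine HolderDom.bind hb ih fun hist => HolderDom.bind hb (HolderDom.refl hb _) fun x => ?_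
    exact (holderDom_of_le hab hε₀ (expMechanism_ne_zero _ _ _)
      (expMechanism_le hε₀.le fun r => abs_score_sub_le Q x h r)
      (expMechanism_le hε₀.le fun r => abs_score_sub_le Q x h.symm r)).map _

theorem isDP_sepFEM {X : Type*} [Fintype X] [DecidableEq X] {n : ℕ} (O : ArgmaxOracle X)
    (Q : Finset (X → Bool)) [Nonempty Q] (S : Finset (X → Bool)) {ρ : ℝ} (hρ : 0 < ρ)
    {T : ℕ} (hT : 1 ≤ T) (η : ℝ) (s : ℕ) {δ : ℝ} (hδ : 0 < δ) (hδ1 : δ < 1) :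
    IsDP (n := n) (sepFEM O Q S ρ T η s) (ρ + 2 * Real.sqrt (ρ * Real.log (1 / δ))) δ := by
  intro D D' h E
  have hT0 : (0 : ℝ) < T := by exact_mod_cast hT
  set l := Real.log (1 / δ) with hl
  have hl0 : 0 < l := Real.log_pos (by rw [lt_div_iff₀ hδ]; linarith)
  -- The order is `a = m + 1`. The exponent of the additive error is `m² ρ - 2 m √(ρ l)`, minimized
  -- by this `m` with value `-l = log δ`.
  set m := Real.sqrt (l / ρ) with hm
  have hm0 : 0 < m := Real.sqrt_pos.2 (by positivity)
  have hab : (m + 1).HolderConjugate (m + 1).conjExponent :=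
    Real.HolderConjugate.conjExponent (by linarith)
  have h1 := (holderDom_transcript O Q S (ε₀ := Real.sqrt (2 * (ρ / T)))
    (Real.sqrt_pos.2 (by positivity)) η s h hab T).map
      (fun h : List Q × List (Fin s → X) => fun y => (h.2.map fun x => empirical x y).sum / (T : ℝ))
  have e1 : (T : ℝ) * ((m + 1 - 1) * Real.sqrt (2 * (ρ / T)) ^ 2 / 2) = m * ρ := by
    rw [Real.sq_sqrt (by positivity)]
    field_simp
    ring
  rw [e1] at h1
  have h2 := toOuterMeasure_le_of_holderDom (ε := ρ + 2 * Real.sqrt (ρ * l)) hab h1 E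
  refine h2.trans (le_of_eq ?_)
  congr 2
  have hs : Real.sqrt (ρ * l) = ρ * m := by
    rw [hm, Real.sqrt_eq_iff_eq_sq (by positivity) (by positivity), mul_pow,
      Real.sq_sqrt (by positivity)]
    field_simp
  have hm2 : m ^ 2 = l / ρ := Real.sq_sqrt (by positivity)
  have e2 : (m + 1) * (m * ρ) - (m + 1 - 1) * (ρ + 2 * Real.sqrt (ρ * l)) = -l := by
    rw [hs]
    have : (m + 1) * (m * ρ) - (m + 1 - 1) * (ρ + 2 * (ρ * m)) = -(m ^ 2) * ρ := by ring
    rw [this, hm2]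
    field_simp
  rw [e2, hl, one_div, Real.log_inv, neg_neg, Real.exp_log hδ]

/-! ### The Laplace distribution -/

theorem laplace_of_pos {b : ℝ} (hb : 0 < b) :
    laplace b = volume.withDensity fun x => ENNReal.ofReal (Real.exp (-|x| / b) / (2 * b)) :=
  if_pos hb

theorem measurable_laplaceDensity (b : ℝ) :
    Measurable fun x : ℝ => ENNReal.ofReal (Real.exp (-|x| / b) / (2 * b)) := by
  fun_prop

theorem laplace_map_add_le {b : ℝ} (hb : 0 < b) (c : ℝ) :
    (laplace b).map (· + c) ≤ ENNReal.ofReal (Real.exp (|c| / b)) • laplace b := by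
  refine Measure.le_iff.2 fun s hs => ?_
  have hm := measurable_laplaceDensity b
  rw [Measure.map_apply (measurable_add_const c) hs, Measure.smul_apply, laplace_of_pos hb,
    withDensity_apply _ (measurable_add_const c hs), withDensity_apply _ hs, smul_eq_mul,
    ← lintegral_const_mul _ hm, ← lintegral_indicator (measurable_add_const c hs),
    ← lintegral_indicator hs,
    ← lintegral_add_right_eq_self (μ := volume) (Set.indicator s _) c]
  refine lintegral_mono fun x => ?_
  by_cases hx : x + c ∈ s
  · have hx' : x ∈ (fun y => y + c) ⁻¹' s := hx
    rw [Set.indicator_of_mem hx, Set.indicator_of_mem hx', ← ENNReal.ofReal_mul (Real.exp_pos _).le]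
    refine ENNReal.ofReal_le_ofReal ?_
    rw [← mul_div_assoc, ← Real.exp_add]
    gcongr
    rw [← add_div]
    gcongr
    have := abs_add_le x c
    linarith
  · have hx' : x ∉ (fun y => y + c) ⁻¹' s := hx
    rw [Set.indicator_of_notMem hx']
    exact zero_le

/-- The product measure comes from the largest outer measure bounded on boxes by the product of the
side measures, so a comparison on boxes suffices. -/
theorem pi_le_smul_pi {ι : Type*} [Fintype ι] {α : ι → Type*} [∀ i, MeasurableSpace (α i)]
    {μ ν : ∀ i, Measure (α i)} [∀ i, SigmaFinite (μ i)] {c : ℝ≥0∞} (hc : c ≠ 0) (hc' : c ≠ ⊤)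
    (h : ∀ i, μ i ≤ c • ν i) :
    Measure.pi μ ≤ c ^ Fintype.card ι • Measure.pi ν := by
  have hk : c ^ Fintype.card ι ≠ 0 := pow_ne_zero _ hc
  have hk' : c ^ Fintype.card ι ≠ ⊤ := ENNReal.pow_ne_top hc'
  have h1 : (c ^ Fintype.card ι)⁻¹ • (Measure.pi μ).toOuterMeasure ≤
      OuterMeasure.pi fun i => (ν i).toOuterMeasure := by
    rw [OuterMeasure.le_pi]
    intro s _
    rw [_root_.smul_apply, smul_eq_mul, ENNReal.inv_mul_le_iff hk hk']
    have e : c ^ Fintype.card ι = ∏ _i : ι, c := by simp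
    rw [e, ← Finset.prod_mul_distrib]
    change Measure.pi μ (Set.univ.pi s) ≤ _
    rw [Measure.pi_pi]
    exact Finset.prod_le_prod' fun i _ => h i (s i)
  refine Measure.le_iff.2 fun s hs => ?_
  rw [Measure.smul_apply, smul_eq_mul, ← ENNReal.inv_mul_le_iff hk hk', Measure.pi_def ν,
    toMeasure_apply _ _ hs]
  exact h1 s

theorem pi_laplace_map_add_le {ι : Type*} [Fintype ι] {b : ℝ} (hb : 0 < b) {v : ι → ℝ} {c : ℝ}
    (hv : ∀ i, |v i| ≤ c) :
    (Measure.pi fun _ : ι => laplace b).map (· + v) ≤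
      ENNReal.ofReal (Real.exp (c * Fintype.card ι / b)) • Measure.pi fun _ : ι => laplace b := by
  have hp : ∀ i, IsProbabilityMeasure ((laplace b).map (· + v i)) := fun i =>
    Measure.isProbabilityMeasure_map (measurable_add_const _).aemeasurable
  have h1 := Measure.pi_map_pi (μ := fun _ : ι => laplace b) (f := fun i x => x + v i)
    (fun i => (measurable_add_const (v i)).aemeasurable)
  change (Measure.pi fun _ : ι => laplace b).map (fun x i => x i + v i) ≤ _
  rw [h1]
  refine (pi_le_smul_pi (c := ENNReal.ofReal (Real.exp (c / b))) (by simp [Real.exp_pos])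
    ENNReal.ofReal_ne_top (ν := fun _ => laplace b)
    fun i => (laplace_map_add_le hb (v i)).trans ?_).trans (le_of_eq ?_)
  · refine Measure.le_iff.2 fun s _ => ?_
    rw [Measure.smul_apply, Measure.smul_apply, smul_eq_mul, smul_eq_mul]
    gcongr
    exact hv i
  · congr 1
    rw [← ENNReal.ofReal_pow (Real.exp_pos _).le, ← Real.exp_nat_mul]
    congr 2
    ring

theorem laplace_mgf {b : ℝ} (hb : 0 < b) {c : ℝ} (hc : |c * b| < 1) :
    Integrable (fun x => Real.exp (c * x)) (laplace b) ∧
      ∫ x, Real.exp (c * x) ∂laplace b = 1 / (1 - (c * b) ^ 2) := by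
  have hm := measurable_laplaceDensity b
  have hfin : ∀ᵐ x : ℝ, ENNReal.ofReal (Real.exp (-|x| / b) / (2 * b)) < ⊤ :=
    Filter.Eventually.of_forall fun x => ENNReal.ofReal_lt_top
  rw [abs_lt] at hc
  have hc1 : c < b⁻¹ := by rw [← one_div, lt_div_iff₀ hb]; linarith
  have hc2 : -c < b⁻¹ := by rw [← one_div, lt_div_iff₀ hb]; linarith
  have hR : ∀ x : ℝ, (ENNReal.ofReal (Real.exp (-|x| / b) / (2 * b))).toReal • Real.exp (c * x) =
      Real.exp (-|x| / b) / (2 * b) * Real.exp (c * x) := fun x => by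
    rw [ENNReal.toReal_ofReal (by positivity), smul_eq_mul]
  have hpos : ∀ x ∈ Set.Ioi (0 : ℝ), Real.exp (-|x| / b) / (2 * b) * Real.exp (c * x) =
      Real.exp ((c - b⁻¹) * x) / (2 * b) := fun x hx => by
    rw [abs_of_pos hx, div_mul_eq_mul_div, ← Real.exp_add]
    congr 2; ring
  have hneg : ∀ x ∈ Set.Iic (0 : ℝ), Real.exp (-|x| / b) / (2 * b) * Real.exp (c * x) =
      Real.exp ((c + b⁻¹) * x) / (2 * b) := fun x hx => by
    rw [abs_of_nonpos hx, div_mul_eq_mul_div, ← Real.exp_add]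
    congr 2; ring
  have i1 : IntegrableOn (fun x : ℝ => Real.exp (-|x| / b) / (2 * b) * Real.exp (c * x))
      (Set.Ioi 0) :=
    (integrableOn_exp_mul_Ioi (a := c - b⁻¹) (by linarith) 0).div_const (2 * b) |>.congr
      ((ae_restrict_iff' measurableSet_Ioi).2 (.of_forall fun x hx => (hpos x hx).symm))
  have i2 : IntegrableOn (fun x : ℝ => Real.exp (-|x| / b) / (2 * b) * Real.exp (c * x))
      (Set.Iic 0) :=
    (integrableOn_exp_mul_Iic (a := c + b⁻¹) (by linarith) 0).div_const (2 * b) |>.congr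
      ((ae_restrict_iff' measurableSet_Iic).2 (.of_forall fun x hx => (hneg x hx).symm))
  have i3 : Integrable (fun x : ℝ => Real.exp (-|x| / b) / (2 * b) * Real.exp (c * x)) := by
    rw [← integrableOn_univ, ← Set.Iic_union_Ioi (a := (0 : ℝ))]
    exact i2.union i1
  rw [laplace_of_pos hb]
  constructor
  · rw [integrable_withDensity_iff_integrable_smul' hm hfin]
    simpa only [hR] using i3
  · rw [integral_withDensity_eq_integral_toReal_smul hm hfin]
    simp only [hR]
    rw [← intervalIntegral.integral_Iic_add_Ioi i2 i1,
      setIntegral_congr_fun measurableSet_Ioi hpos, setIntegral_congr_fun measurableSet_Iic hneg,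
      integral_div, integral_div, integral_exp_mul_Ioi (by linarith),
      integral_exp_mul_Iic (by linarith)]
    have h1 : c * b - 1 ≠ 0 := by linarith
    have h2 : c * b + 1 ≠ 0 := by linarith
    have e1 : c - b⁻¹ = (c * b - 1) / b := by field_simp
    have e2 : c + b⁻¹ = (c * b + 1) / b := by field_simp
    have e3 : 1 - (c * b) ^ 2 = -((c * b - 1) * (c * b + 1)) := by ring
    rw [mul_zero, mul_zero, Real.exp_zero, e1, e2, e3]
    field_simp
    ring

/-- For `0 ≤ x ≤ 1 / 2`, `1 / (1 - x) ≤ 1 + 2 x ≤ exp (2 x)`. -/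
theorem laplace_mgf_le {b : ℝ} (hb : 0 < b) {c : ℝ} (hc : (c * b) ^ 2 ≤ 1 / 2) :
    Integrable (fun x => Real.exp (c * x)) (laplace b) ∧
      ∫ x, Real.exp (c * x) ∂laplace b ≤ Real.exp (2 * (c * b) ^ 2) := by
  have hcb : |c * b| < 1 := abs_lt.2 ⟨by nlinarith, by nlinarith⟩
  obtain ⟨h1, h2⟩ := laplace_mgf hb hcb
  refine ⟨h1, ?_⟩
  rw [h2, div_le_iff₀ (by linarith)]
  have := Real.add_one_le_exp (2 * (c * b) ^ 2)
  nlinarith [sq_nonneg (c * b)]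

/-! ### Regret of follow the perturbed leader -/

/-- The joint law of the perturbations. -/
noncomputable abbrev noiseLaw {X : Type*} (S : Finset (X → Bool)) (η : ℝ) : Measure (S → ℝ) :=
  Measure.pi fun _ : S => laplace η

theorem ftpl_apply {X : Type*} [Fintype X] (O : ArgmaxOracle X) (S : Finset (X → Bool))
    (η : ℝ) (qs : List (X → Bool)) (x : X) :
    ftpl O S η qs x = noiseLaw S η {σ | O.pick (objective S qs σ) = x} := rfl

theorem objective_cons {X : Type*} (S : Finset (X → Bool)) (q : X → Bool) (qs : List (X → Bool))
    (σ : S → ℝ) (x : X) :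
    objective S (q :: qs) σ x = ((q x).toNat : ℝ) + objective S qs σ x := by
  simp only [objective, List.map_cons, List.sum_cons]
  ring

theorem objective_add {X : Type*} (S : Finset (X → Bool)) (qs : List (X → Bool))
    (σ v : S → ℝ) (x : X) :
    objective S qs (σ + v) x = objective S qs σ x + ∑ q : S, v q * ((q.1 x).toNat : ℝ) := by
  simp only [objective, Pi.add_apply, add_mul, Finset.sum_add_distrib]
  ring

/-- Stability: adding a query to the objective increases the probability of no record by more than
a factor `exp (2 |S| / η)`. -/
theorem ftpl_cons_le {X : Type*} [Fintype X] (O : ArgmaxOracle X) {S : Finset (X → Bool)}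
    (hS : IsSeparator S) {η : ℝ} (hη : 0 < η) (q : X → Bool) (qs : List (X → Bool)) (x : X) :
    ftpl O S η (q :: qs) x ≤ ENNReal.ofReal (Real.exp (2 * S.card / η)) * ftpl O S η qs x := by
  rw [ftpl_apply, ftpl_apply]
  -- This shift never favours a rival `x'` over `x` in any coordinate, and it favours `x` by 2 on a
  -- separating predicate. Removing `q` changes a comparison by at most 1, so `x` stays the unique
  -- maximizer and the oracle's tie-breaking is irrelevant.
  set v : S → ℝ := fun p => if p.1 x then 2 else -2 with hv
  have hvle : ∀ p, |v p| ≤ 2 := fun p => by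
    simp only [hv]; split_ifs <;> norm_num
  have hsub : {σ | O.pick (objective S (q :: qs) σ) = x} ⊆
      (· + v) ⁻¹' {σ | O.pick (objective S qs σ) = x} := by
    intro σ hσ
    simp only [Set.mem_ofPred_eq] at hσ
    by_contra hne
    simp only [Set.mem_preimage, Set.mem_ofPred_eq] at hne
    set x' := O.pick (objective S qs (σ + v))
    have h1 := O.le_pick (objective S qs (σ + v)) x
    change _ ≤ objective S qs (σ + v) x' at h1
    have h2 := O.le_pick (objective S (q :: qs) σ) x'
    rw [hσ, objective_cons, objective_cons] at h2
    rw [objective_add, objective_add] at h1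
    have h3 := (abs_le.1 (abs_toNat_sub_le (q x) (q x'))).2
    have h4 : 2 ≤ ∑ p : S, (v p * ((p.1 x).toNat : ℝ) - v p * ((p.1 x').toNat : ℝ)) := by
      have hnn : ∀ p : S, 0 ≤ v p * ((p.1 x).toNat : ℝ) - v p * ((p.1 x').toNat : ℝ) := by
        intro p
        simp only [hv]
        cases p.1 x <;> cases p.1 x' <;> simp
      obtain ⟨p, hp, hpx⟩ := hS x x' (Ne.symm hne)
      refine le_trans (le_of_eq ?_)
        (Finset.single_le_sum (fun p _ => hnn p) (Finset.mem_univ (⟨p, hp⟩ : S)))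
      have hbool : ∀ b b' : Bool, b ≠ b' → (2 : ℝ) =
          (if b then 2 else -2) * (b.toNat : ℝ) - (if b then 2 else -2) * (b'.toNat : ℝ) := by
        intro b b'
        cases b <;> cases b' <;> simp
      exact hbool _ _ hpx
    rw [Finset.sum_sub_distrib] at h4
    linarith
  have hmeas : MeasurableSet {σ : S → ℝ | O.pick (objective S qs σ) = x} :=
    measurable_objective S qs (O.measurableSet_pick x)
  calc noiseLaw S η {σ | O.pick (objective S (q :: qs) σ) = x}
      ≤ noiseLaw S η ((· + v) ⁻¹' {σ | O.pick (objective S qs σ) = x}) := measure_mono hsub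
    _ = (noiseLaw S η).map (· + v) {σ | O.pick (objective S qs σ) = x} :=
        (Measure.map_apply (measurable_add_const v) hmeas).symm
    _ ≤ _ := by
        have := pi_laplace_map_add_le hη hvle {σ | O.pick (objective S qs σ) = x}
        rwa [Fintype.card_coe, Measure.smul_apply, smul_eq_mul] at this

/-- The expected value of a query on a sample. -/
noncomputable def expAnswer {X : Type*} [Fintype X] (p : PMF X) (q : X → Bool) : ℝ :=
  answerDist q fun x => (p x).toReal

theorem sum_toReal {X : Type*} [Fintype X] (p : PMF X) : ∑ x, (p x).toReal = 1 := by
  rw [← ENNReal.toReal_sum fun r _ => p.apply_ne_top r,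
    ← tsum_fintype (L := .unconditional X), p.tsum_coe, ENNReal.toReal_one]

theorem answerDist_le_one {X : Type*} [Fintype X] (q : X → Bool) {w : X → ℝ} (h0 : ∀ x, 0 ≤ w x)
    (h1 : ∑ x, w x = 1) : answerDist q w ≤ 1 := by
  rw [← h1]
  refine Finset.sum_le_sum fun x _ => ?_
  cases q x <;> simp [h0]

theorem answerDist_nonneg {X : Type*} [Fintype X] (q : X → Bool) {w : X → ℝ} (h0 : ∀ x, 0 ≤ w x) :
    0 ≤ answerDist q w :=
  Finset.sum_nonneg fun x _ => mul_nonneg (h0 x) (Nat.cast_nonneg _)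

theorem expAnswer_le_one {X : Type*} [Fintype X] (p : PMF X) (q : X → Bool) : expAnswer p q ≤ 1 :=
  answerDist_le_one q (fun _ => ENNReal.toReal_nonneg) (sum_toReal p)

/-- Multiplicative stability becomes additive since answers lie in `[0, 1]`: `exp (-κ) u ≥ (1 - κ) u
≥ u - κ`, with no smallness of `κ` required. -/
theorem expAnswer_ftpl_cons_le {X : Type*} [Fintype X] (O : ArgmaxOracle X)
    {S : Finset (X → Bool)} (hS : IsSeparator S) {η : ℝ} (hη : 0 < η) (q : X → Bool)
    (qs : List (X → Bool)) (q' : X → Bool) :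
    expAnswer (ftpl O S η (q :: qs)) q' ≤ expAnswer (ftpl O S η qs) q' + 2 * S.card / η := by
  set κ : ℝ := 2 * S.card / η
  have h1 : expAnswer (ftpl O S η (q :: qs)) q' ≤ Real.exp κ * expAnswer (ftpl O S η qs) q' := by
    unfold expAnswer answerDist
    rw [Finset.mul_sum]
    refine Finset.sum_le_sum fun x _ => ?_
    rw [← mul_assoc]
    gcongr
    have := ENNReal.toReal_mono (ENNReal.mul_ne_top ENNReal.ofReal_ne_top
      ((ftpl O S η qs).apply_ne_top x)) (ftpl_cons_le O hS hη q qs x)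
    rwa [ENNReal.toReal_mul, ENNReal.toReal_ofReal (Real.exp_pos _).le] at this
  have hκ : 0 ≤ κ := by positivity
  have h2 := expAnswer_le_one (ftpl O S η (q :: qs)) q'
  have h4 : 0 ≤ expAnswer (ftpl O S η (q :: qs)) q' :=
    answerDist_nonneg _ fun _ => ENNReal.toReal_nonneg
  have h3 : Real.exp (-κ) * expAnswer (ftpl O S η (q :: qs)) q' ≤
      expAnswer (ftpl O S η qs) q' := by
    rw [Real.exp_neg, inv_mul_le_iff₀ (Real.exp_pos _)]; exact h1
  have h5 := Real.add_one_le_exp (-κ)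
  nlinarith

theorem integrable_answer_pick {X : Type*} [Fintype X] (O : ArgmaxOracle X)
    (S : Finset (X → Bool)) (η : ℝ) (qs : List (X → Bool)) (q : X → Bool) :
    Integrable (fun σ => ((q (O.pick (objective S qs σ))).toNat : ℝ)) (noiseLaw S η) ∧
      ∫ σ, ((q (O.pick (objective S qs σ))).toNat : ℝ) ∂noiseLaw S η =
        expAnswer (ftpl O S η qs) q := by
  classical
  have hmeas : ∀ x, MeasurableSet {σ : S → ℝ | O.pick (objective S qs σ) = x} := fun x =>
    measurable_objective S qs (O.measurableSet_pick x)
  have e : (fun σ => ((q (O.pick (objective S qs σ))).toNat : ℝ)) = fun σ =>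
      ∑ x, Set.indicator {σ : S → ℝ | O.pick (objective S qs σ) = x}
        (fun _ => ((q x).toNat : ℝ)) σ := by
    funext σ
    simp [Set.indicator_apply]
  have hint : ∀ x ∈ (Finset.univ : Finset X), Integrable
      (Set.indicator {σ : S → ℝ | O.pick (objective S qs σ) = x}
        (fun _ => ((q x).toNat : ℝ))) (noiseLaw S η) := fun x _ =>
    (integrable_const _).indicator (hmeas x)
  rw [e]
  refine ⟨integrable_finsetSum _ hint, ?_⟩
  rw [integral_finsetSum _ hint]
  unfold expAnswer answerDist
  refine Finset.sum_congr rfl fun x _ => ?_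
  rw [integral_indicator_const _ (hmeas x), smul_eq_mul]
  rfl

/-- The total answer of the leaders: each query is evaluated on the sample drawn after it. -/
noncomputable def leaderSum {X : Type*} (O : ArgmaxOracle X) (S : Finset (X → Bool)) (σ : S → ℝ) :
    List (X → Bool) → ℝ
  | [] => 0
  | q :: qs => ((q (O.pick (objective S (q :: qs) σ))).toNat : ℝ) + leaderSum O S σ qs

/-- The total expected answer of the samples: each query is evaluated on the sample drawn before
it. -/
noncomputable def followerSum {X : Type*} [Fintype X] (O : ArgmaxOracle X) (S : Finset (X → Bool))
    (η : ℝ) : List (X → Bool) → ℝ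
  | [] => 0
  | q :: qs => expAnswer (ftpl O S η qs) q + followerSum O S η qs

/-- Be-the-leader: on the earlier queries, the maximizer for `q :: qs` does no better than the
maximizer for `qs`. The perturbation plays the part of a query at time zero. -/
theorem objective_pick_le {X : Type*} (O : ArgmaxOracle X) (S : Finset (X → Bool)) (σ : S → ℝ)
    {w : ℝ} (hw : ∀ x, objective S [] σ x ≤ w) (qs : List (X → Bool)) :
    objective S qs σ (O.pick (objective S qs σ)) ≤ leaderSum O S σ qs + w := by
  induction qs with
  | nil => simpa [leaderSum] using hw _
  | cons q qs ih =>
    rw [objective_cons, leaderSum]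
    have := O.le_pick (objective S qs σ) (O.pick (objective S (q :: qs) σ))
    linarith

/-- Stability replaces each leader by the preceding follower. One noise vector may serve all rounds
because only the expectation of each summand matters. -/
theorem integrable_leaderSum {X : Type*} [Fintype X] (O : ArgmaxOracle X) {S : Finset (X → Bool)}
    (hS : IsSeparator S) {η : ℝ} (hη : 0 < η) (qs : List (X → Bool)) :
    Integrable (fun σ => leaderSum O S σ qs) (noiseLaw S η) ∧
      ∫ σ, leaderSum O S σ qs ∂noiseLaw S η ≤
        followerSum O S η qs + qs.length * (2 * S.card / η) := by
  induction qs with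
  | nil => simp [leaderSum, followerSum]
  | cons q qs ih =>
    obtain ⟨h1, h2⟩ := integrable_answer_pick O S η (q :: qs) q
    simp only [leaderSum, followerSum]
    refine ⟨h1.add ih.1, ?_⟩
    rw [integral_add h1 ih.1, h2]
    have := expAnswer_ftpl_cons_le O hS hη q qs q
    rw [List.length_cons]
    push_cast
    linarith [ih.2]

theorem exp_noise_eq_prod {X : Type*} (S : Finset (X → Bool)) (c : ℝ) (x : X) (σ : S → ℝ) :
    Real.exp (c * objective S [] σ x) = ∏ q : S, Real.exp (c * ((q.1 x).toNat : ℝ) * σ q) := by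
  rw [← Real.exp_sum]
  congr 1
  simp only [objective, List.map_nil, List.sum_nil, zero_add, Finset.mul_sum]
  exact Finset.sum_congr rfl fun q _ => by ring

theorem noise_mgf_le {X : Type*} (S : Finset (X → Bool)) {η : ℝ} (hη : 0 < η) {c : ℝ}
    (hc : (c * η) ^ 2 ≤ 1 / 2) (x : X) :
    Integrable (fun σ => Real.exp (c * objective S [] σ x)) (noiseLaw S η) ∧
      ∫ σ, Real.exp (c * objective S [] σ x) ∂noiseLaw S η ≤
        Real.exp (S.card * (2 * (c * η) ^ 2)) := by
  have hb : ∀ b : Bool, (c * (b.toNat : ℝ) * η) ^ 2 ≤ (c * η) ^ 2 := fun b => by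
    cases b <;> simp; positivity
  simp only [exp_noise_eq_prod]
  have h := fun q : S => laplace_mgf_le hη (c := c * ((q.1 x).toNat : ℝ)) ((hb _).trans hc)
  refine ⟨Integrable.fintype_prod (f := fun (q : S) y => Real.exp (c * ((q.1 x).toNat : ℝ) * y))
    fun q => (h q).1, ?_⟩
  rw [integral_fintype_prod_eq_prod
    (f := fun (q : S) y => Real.exp (c * ((q.1 x).toNat : ℝ) * y))]
  calc _ ≤ ∏ _q : S, Real.exp (2 * (c * η) ^ 2) := by
        refine Finset.prod_le_prod (fun q _ => integral_nonneg fun y => (Real.exp_pos _).le)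
          fun q _ => (h q).2.trans (Real.exp_le_exp.2 ?_)
        have := hb (q.1 x)
        linarith
    _ = _ := by
        rw [Finset.prod_const, ← Real.exp_nat_mul, Finset.card_univ, Fintype.card_coe]

/-- The perturbations of all records have an integrable common bound of small expectation. -/
theorem exists_noise_bound {X : Type*} [Fintype X] [Nonempty X] {S : Finset (X → Bool)}
    (hS : 0 < S.card) {η : ℝ} (hη : 0 < η) :
    ∃ w : (S → ℝ) → ℝ, Integrable w (noiseLaw S η) ∧ (∀ σ x, |objective S [] σ x| ≤ w σ) ∧
      ∫ σ, w σ ∂noiseLaw S η ≤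
        2 * η * Real.sqrt S.card * (Real.log (2 * Fintype.card X) + 1 / 2) := by
  have hS0 : (0 : ℝ) < S.card := by exact_mod_cast hS
  have hX0 : (0 : ℝ) < Fintype.card X := by exact_mod_cast Fintype.card_pos
  -- With this `c` the exponential moments of every record's perturbation at `c` and `-c` are at
  -- most `exp (1 / 2)`, so `A` below bounds the expectation of their sum over all records.
  set c : ℝ := 1 / (2 * η * Real.sqrt S.card) with hc
  have hsq : 0 < Real.sqrt S.card := Real.sqrt_pos.2 hS0
  have hc0 : 0 < c := by positivity
  have hcη : (c * η) ^ 2 = 1 / (4 * S.card) := by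
    have : c * η = 1 / (2 * Real.sqrt S.card) := by rw [hc]; field_simp
    rw [this, div_pow, mul_pow, Real.sq_sqrt hS0.le]; norm_num
  have hS1 : (1 : ℝ) ≤ S.card := by exact_mod_cast hS
  have hcη2 : (c * η) ^ 2 ≤ 1 / 2 := by
    rw [hcη, div_le_div_iff₀ (by positivity) (by norm_num)]; linarith
  have hcη2' : (-c * η) ^ 2 ≤ 1 / 2 := by rwa [neg_mul, neg_sq]
  have hexp : (S.card : ℝ) * (2 * (c * η) ^ 2) = 1 / 2 := by rw [hcη]; field_simp; norm_num
  set A : ℝ := 2 * Fintype.card X * Real.exp (1 / 2) with hA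
  have hA0 : 0 < A := by positivity
  have hlogA : Real.log A = Real.log (2 * Fintype.card X) + 1 / 2 := by
    rw [hA, Real.log_mul (by positivity) (Real.exp_pos _).ne', Real.log_exp]
  set g : X → (S → ℝ) → ℝ := fun x σ =>
    Real.exp (c * objective S [] σ x) + Real.exp (-c * objective S [] σ x) with hg
  have hgi : ∀ x, Integrable (g x) (noiseLaw S η) := fun x =>
    (noise_mgf_le S hη hcη2 x).1.add (noise_mgf_le S hη hcη2' x).1
  have hgle : ∀ x, ∫ σ, g x σ ∂noiseLaw S η ≤ 2 * Real.exp (1 / 2) := fun x => by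
    have h1 := noise_mgf_le S hη hcη2 x
    have h2 := noise_mgf_le S hη hcη2' x
    rw [neg_mul c η, neg_sq, hexp] at h2
    rw [hexp] at h1
    simp only [hg]
    rw [integral_add h1.1 h2.1]
    linarith [h1.2, h2.2]
  have hsum : Integrable (fun σ => ∑ x, g x σ) (noiseLaw S η) :=
    integrable_finsetSum _ fun x _ => hgi x
  -- The logarithm of `∑ x, g x σ` is replaced by its tangent at `A`, so that the bound is affine in
  -- the exponentials; its expectation is then at most `log A / c`.
  refine ⟨fun σ => (Real.log A - 1 + (∑ x, g x σ) / A) / c,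
    ((integrable_const _).add (hsum.div_const A)).div_const c, fun σ x => ?_, ?_⟩
  · rw [le_div_iff₀ hc0]
    have h1 : Real.exp (|objective S [] σ x| * c) ≤ ∑ x, g x σ := by
      refine le_trans ?_ (Finset.single_le_sum (f := fun x => g x σ)
        (fun x _ => by positivity) (Finset.mem_univ x))
      simp only [hg]
      rcases abs_cases (objective S [] σ x) with ⟨h, _⟩ | ⟨h, _⟩
      · rw [h, mul_comm]
        exact le_add_of_nonneg_right (Real.exp_pos _).le
      · rw [h, mul_comm, mul_neg, ← neg_mul]
        exact le_add_of_nonneg_left (Real.exp_pos _).le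
    have h2 := Real.add_one_le_exp (|objective S [] σ x| * c - Real.log A)
    rw [Real.exp_sub, Real.exp_log hA0] at h2
    have h3 := (div_le_div_iff_of_pos_right hA0).2 h1
    linarith
  · rw [integral_div, integral_add (integrable_const _) (hsum.div_const A), integral_div,
      integral_finsetSum _ fun x _ => hgi x]
    have h1 : ∑ x, ∫ σ, g x σ ∂noiseLaw S η ≤ A := by
      refine (Finset.sum_le_sum fun x _ => hgle x).trans (le_of_eq ?_)
      rw [Finset.sum_const, Finset.card_univ, nsmul_eq_mul, hA]
      ring
    have h2 : (∑ x, ∫ σ, g x σ ∂noiseLaw S η) / A ≤ 1 := (div_le_one hA0).2 h1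
    simp only [integral_const, probReal_univ, one_smul]
    rw [div_le_iff₀ hc0, ← hlogA]
    have h3 : 2 * η * Real.sqrt S.card * Real.log A * c = Real.log A := by
      rw [hc]; field_simp
    linarith

/-- The noise bound is spent twice, on the perturbation of the leader and on that of the competitor
`x`, before taking expectations of the pathwise inequality. -/
theorem regret_le {X : Type*} [Fintype X] (O : ArgmaxOracle X) {S : Finset (X → Bool)}
    (hS : IsSeparator S) (hS0 : 0 < S.card) {η : ℝ} (hη : 0 < η) (qs : List (X → Bool)) (x : X) :
    (qs.map fun q => ((q x).toNat : ℝ)).sum ≤ followerSum O S η qs +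
      qs.length * (2 * S.card / η) +
        4 * η * Real.sqrt S.card * (Real.log (2 * Fintype.card X) + 1 / 2) := by
  have : Nonempty X := ⟨x⟩
  obtain ⟨w, hwi, hw, hwle⟩ := exists_noise_bound hS0 hη
  obtain ⟨hli, hlle⟩ := integrable_leaderSum O hS hη qs
  have hpt : ∀ σ, (qs.map fun q => ((q x).toNat : ℝ)).sum ≤
      leaderSum O S σ qs + (w σ + w σ) := fun σ => by
    have h1 := objective_pick_le O S σ (fun x => (abs_le.1 (hw σ x)).2) qs
    have h2 := O.le_pick (objective S qs σ) x
    have h3 : objective S qs σ x =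
        (qs.map fun q => ((q x).toNat : ℝ)).sum + objective S [] σ x := by
      simp [objective]
    have h4 := (abs_le.1 (hw σ x)).1
    linarith
  have h := integral_mono (μ := noiseLaw S η) (integrable_const _) (hli.add (hwi.add hwi)) hpt
  have e : ∫ σ, ((fun σ => leaderSum O S σ qs) + (w + w)) σ ∂noiseLaw S η =
      ∫ σ, leaderSum O S σ qs ∂noiseLaw S η +
        (∫ σ, w σ ∂noiseLaw S η + ∫ σ, w σ ∂noiseLaw S η) :=
    (integral_add hli (hwi.add hwi)).trans (by rw [integral_add' hwi hwi])
  rw [e, integral_const, probReal_univ, one_smul] at h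
  linarith

/-! ### Accuracy -/

theorem answerDist_empirical {X : Type*} [Fintype X] [DecidableEq X] {s : ℕ} (q : X → Bool)
    (x : Fin s → X) : answerDist q (empirical x) = (∑ j, ((q (x j)).toNat : ℝ)) / s := by
  unfold answerDist empirical
  simp only [div_mul_eq_mul_div, ← Finset.sum_div, Finset.card_filter, Nat.cast_sum, Finset.sum_mul]
  rw [Finset.sum_comm]
  congr 1
  refine Finset.sum_congr rfl fun j _ => ?_
  simp

theorem empirical_nonneg {X : Type*} [DecidableEq X] {s : ℕ} (x : Fin s → X) (y : X) :
    0 ≤ empirical x y := by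
  unfold empirical
  positivity

theorem sum_empirical {X : Type*} [Fintype X] [DecidableEq X] {s : ℕ} (hs : 1 ≤ s)
    (x : Fin s → X) : ∑ y, empirical x y = 1 := by
  have h := answerDist_empirical (fun _ => true) x
  have hs0 : (s : ℝ) ≠ 0 := by positivity
  simpa [answerDist, hs0] using h

theorem answer_const {X : Type*} {n : ℕ} (hn : 1 ≤ n) {q : X → Bool} {b : Bool}
    (hq : ∀ x, q x = b) (D : Fin n → X) : answer q D = (b.toNat : ℝ) := by
  have hn0 : (n : ℝ) ≠ 0 := by positivity
  simp only [answer, hq, Finset.sum_const, Finset.card_univ, Fintype.card_fin, nsmul_eq_mul]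
  field_simp

theorem answerDist_const {X : Type*} [Fintype X] {q : X → Bool} {b : Bool}
    (hq : ∀ x, q x = b) {w : X → ℝ} (hw : ∑ x, w x = 1) : answerDist q w = (b.toNat : ℝ) := by
  simp only [answerDist, hq, ← Finset.sum_mul, hw, one_mul]

theorem answer_not {X : Type*} {n : ℕ} (hn : 1 ≤ n) (q : X → Bool) (D : Fin n → X) :
    answer (fun x => !(q x)) D = 1 - answer q D := by
  have hn0 : (n : ℝ) ≠ 0 := by positivity
  have e : ∀ b : Bool, (((!b).toNat : ℕ) : ℝ) = 1 - (b.toNat : ℝ) := fun b => by cases b <;> simp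
  simp only [answer, e, Finset.sum_sub_distrib, sub_div]
  simp [hn0]

theorem answerDist_not {X : Type*} [Fintype X] (q : X → Bool) {w : X → ℝ} (hw : ∑ x, w x = 1) :
    answerDist (fun x => !(q x)) w = 1 - answerDist q w := by
  have e : ∀ b : Bool, (((!b).toNat : ℕ) : ℝ) = 1 - (b.toNat : ℝ) := fun b => by cases b <;> simp
  simp only [answerDist, e, mul_sub, Finset.sum_sub_distrib, mul_one, hw]

/-! ### Concentration of a batch of samples. -/

theorem iid_apply {X : Type*} [Fintype X] (p : PMF X) (s : ℕ) (x : Fin s → X) :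
    iid p s x = ∏ j, p (x j) := rfl

/-- Uses `exp u ≤ 1 + u + u²` for `|u| ≤ 1`; the linear term has mean zero. -/
theorem sum_exp_centered_le {X : Type*} [Fintype X] (p : PMF X) (q : X → Bool) {c : ℝ}
    (hc0 : 0 ≤ c) (hc1 : c ≤ 1) :
    ∑ y, (p y).toReal * Real.exp (c * (expAnswer p q - ((q y).toNat : ℝ))) ≤
      Real.exp (c ^ 2) := by
  set m := expAnswer p q
  have hm1 : m ≤ 1 := expAnswer_le_one p q
  have hm0 : 0 ≤ m := answerDist_nonneg _ fun _ => ENNReal.toReal_nonneg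
  have h : ∀ y, Real.exp (c * (m - ((q y).toNat : ℝ))) ≤
      1 + c * (m - ((q y).toNat : ℝ)) + c ^ 2 := fun y => by
    set u := m - ((q y).toNat : ℝ) with hu
    have hu1 : |u| ≤ 1 := by
      rw [abs_le, hu]
      cases q y <;> simp <;> constructor <;> linarith
    have hcu : |c * u| ≤ 1 := by
      rw [abs_mul, abs_of_nonneg hc0]
      exact mul_le_one₀ hc1 (abs_nonneg _) hu1
    have h1 := (abs_le.1 (Real.abs_exp_sub_one_sub_id_le hcu)).2
    have h2 : u ^ 2 ≤ 1 := (sq_le_one_iff_abs_le_one u).2 hu1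
    nlinarith [sq_nonneg c]
  calc _ ≤ ∑ y, (p y).toReal * (1 + c * (m - ((q y).toNat : ℝ)) + c ^ 2) :=
        Finset.sum_le_sum fun y _ => mul_le_mul_of_nonneg_left (h y) ENNReal.toReal_nonneg
    _ = ∑ y, ((1 + c * m + c ^ 2) * (p y).toReal - c * ((p y).toReal * ((q y).toNat : ℝ))) :=
        Finset.sum_congr rfl fun y _ => by ring
    _ = 1 + c ^ 2 := by
        rw [Finset.sum_sub_distrib, ← Finset.mul_sum, ← Finset.mul_sum, sum_toReal]
        change _ - c * m = _
        ring
    _ ≤ _ := by linarith [Real.add_one_le_exp (c ^ 2)]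

/-- A lower tail bound for the empirical answer. -/
theorem iid_tail_le {X : Type*} [Fintype X] [DecidableEq X] (p : PMF X) (q : X → Bool) {s : ℕ}
    (hs : 1 ≤ s) {τ : ℝ} (hτ0 : 0 < τ) (hτ1 : τ ≤ 1) :
    (iid p s).toOuterMeasure {x | answerDist q (empirical x) < expAnswer p q - τ} ≤
      ENNReal.ofReal (Real.exp (-(s * τ ^ 2 / 4))) := by
  -- The minimizer of `c² - c τ`, the Chernoff exponent per sample.
  set c := τ / 2 with hc
  set m := expAnswer p q
  have hs0 : (0 : ℝ) < s := by exact_mod_cast hs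
  have hone : ∑ y, p y * ENNReal.ofReal (Real.exp (c * (m - ((q y).toNat : ℝ) - τ))) ≤
      ENNReal.ofReal (Real.exp (-(τ ^ 2 / 4))) := by
    have e : ∀ y, p y * ENNReal.ofReal (Real.exp (c * (m - ((q y).toNat : ℝ) - τ))) =
        ENNReal.ofReal ((p y).toReal * Real.exp (c * (m - ((q y).toNat : ℝ))) *
          Real.exp (-(c * τ))) := fun y => by
      rw [mul_assoc, ENNReal.ofReal_mul ENNReal.toReal_nonneg,
        ENNReal.ofReal_toReal (p.apply_ne_top y), ← Real.exp_add]
      congr 3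
      ring
    simp only [e]
    rw [← ENNReal.ofReal_sum_of_nonneg fun y _ => by positivity, ← Finset.sum_mul]
    refine ENNReal.ofReal_le_ofReal ?_
    refine (mul_le_mul_of_nonneg_right (sum_exp_centered_le p q (c := c) (by positivity)
      (by linarith)) (Real.exp_pos _).le).trans (le_of_eq ?_)
    rw [← Real.exp_add]
    congr 1
    rw [hc]; ring
  rw [PMF.toOuterMeasure_apply_fintype]
  calc _ ≤ ∑ x : Fin s → X, ∏ j, p (x j) *
          ENNReal.ofReal (Real.exp (c * (m - ((q (x j)).toNat : ℝ) - τ))) := by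
        refine Finset.sum_le_sum fun x _ => ?_
        refine Set.indicator_le' (g := fun x : Fin s → X => ∏ j, p (x j) *
          ENNReal.ofReal (Real.exp (c * (m - ((q (x j)).toNat : ℝ) - τ))))
          (fun x hx => ?_) (fun _ _ => zero_le) x
        rw [Finset.prod_mul_distrib, iid_apply]
        refine le_mul_of_one_le_right zero_le ?_
        rw [← ENNReal.ofReal_prod_of_nonneg fun j _ => (Real.exp_pos _).le, ← Real.exp_sum,
          ← ENNReal.ofReal_one]
        refine ENNReal.ofReal_le_ofReal (Real.one_le_exp ?_)
        rw [← Finset.mul_sum]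
        refine mul_nonneg (by positivity) ?_
        have hx' : answerDist q (empirical x) < m - τ := hx
        rw [answerDist_empirical, div_lt_iff₀ hs0] at hx'
        simp only [Finset.sum_sub_distrib, Finset.sum_const, Finset.card_univ, Fintype.card_fin,
          nsmul_eq_mul]
        linarith
    _ = ∏ _j : Fin s, ∑ y, p y *
          ENNReal.ofReal (Real.exp (c * (m - ((q y).toNat : ℝ) - τ))) := by
        rw [Finset.prod_univ_sum, Fintype.piFinset_univ]
    _ ≤ ∏ _j : Fin s, ENNReal.ofReal (Real.exp (-(τ ^ 2 / 4))) :=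
        Finset.prod_le_prod' fun _ _ => hone
    _ = _ := by
        rw [Finset.prod_const, Finset.card_univ, Fintype.card_fin,
          ← ENNReal.ofReal_pow (Real.exp_pos _).le, ← Real.exp_nat_mul]
        congr 2; ring

theorem iid_exists_tail_le {X : Type*} [Fintype X] [DecidableEq X] (p : PMF X)
    (Q : Finset (X → Bool)) {s : ℕ} (hs : 1 ≤ s) {τ : ℝ} (hτ0 : 0 < τ) (hτ1 : τ ≤ 1) :
    (iid p s).toOuterMeasure {x | ∃ q ∈ Q, answerDist q (empirical x) < expAnswer p q - τ} ≤
      ENNReal.ofReal (Q.card * Real.exp (-(s * τ ^ 2 / 4))) := by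
  have e : {x : Fin s → X | ∃ q ∈ Q, answerDist q (empirical x) < expAnswer p q - τ} =
      ⋃ q ∈ Q, {x : Fin s → X | answerDist q (empirical x) < expAnswer p q - τ} := by
    ext x; simp
  rw [e]
  refine (measure_biUnion_finset_le Q _).trans ?_
  refine (Finset.sum_le_sum fun q _ => iid_tail_le p q hs hτ0 hτ1).trans (le_of_eq ?_)
  rw [Finset.sum_const, nsmul_eq_mul, ENNReal.ofReal_mul (Nat.cast_nonneg _),
    ENNReal.ofReal_natCast]

/-! ### Utility of the exponential mechanism. -/

theorem sensitivity_score_le {X : Type*} [Fintype X] [DecidableEq X] {n s : ℕ}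
    (Q : Finset (X → Bool)) (x : Fin s → X) :
    sensitivity (score (n := n) Q x) ≤ 1 / n := by
  refine Real.sSup_le ?_ (by positivity)
  rintro v ⟨D, D', r, h, rfl⟩
  rw [score_sub_score]
  exact abs_answer_sub_le _ h

/-- Zero sensitivity forces every query to be constant, since changing one record of a constant
dataset would otherwise move an answer by `1 / n`. Uniform selection is then optimal. -/
theorem score_eq_zero {X : Type*} [Fintype X] [DecidableEq X] {n s : ℕ} {Q : Finset (X → Bool)}
    (hn : 1 ≤ n) (hs : 1 ≤ s) (x : Fin s → X) (h : sensitivity (score (n := n) Q x) ≤ 0)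
    (D : Fin n → X) (q : Q) : score Q x D q = 0 := by
  have hn0 : (0 : ℝ) < n := by exact_mod_cast hn
  have i₀ : Fin n := ⟨0, hn⟩
  have hconst : ∀ y, q.1 y = q.1 (D i₀) := fun y => by
    have hN : Neighbor (fun _ => D i₀) (fun i : Fin n => if i = i₀ then y else D i₀) := by
      unfold Neighbor
      refine (Set.ncard_le_ncard (t := {i₀}) (fun i hi => ?_)).trans (Set.ncard_singleton _).le
      by_contra hne
      rw [Set.mem_singleton_iff] at hne
      exact hi (by simp only [if_neg hne])
    have h1 := (abs_score_sub_le Q x hN q).trans h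
    rw [score_sub_score, abs_nonpos_iff, answer, answer, ← sub_div, ← Finset.sum_sub_distrib,
      div_eq_zero_iff, or_iff_left hn0.ne', Finset.sum_eq_single i₀ (fun i _ hi => by simp [hi])
        (fun hi => absurd (Finset.mem_univ _) hi), if_pos rfl] at h1
    revert h1
    cases q.1 y <;> cases q.1 (D i₀) <;> simp
  unfold score
  rw [answer_const hn hconst, answerDist_const hconst (sum_empirical hs x), sub_self]

/-- The exponential mechanism selects a query of nearly maximal score. -/
theorem expMechanism_tail_le {X : Type*} [Fintype X] [DecidableEq X] {n s : ℕ}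
    {Q : Finset (X → Bool)} [Nonempty Q] (hn : 1 ≤ n) (hs : 1 ≤ s) (x : Fin s → X) {ε ξ : ℝ}
    (hε : 0 < ε) (hξ : 0 ≤ ξ) (D : Fin n → X) :
    (expMechanism (score Q x) ε D).toOuterMeasure
        {q | ∃ q', score Q x D q + ξ < score Q x D q'} ≤
      ENNReal.ofReal (Q.card * Real.exp (-(ε * ξ * n / 2))) := by
  have hn0 : (0 : ℝ) < n := by exact_mod_cast hn
  rw [PMF.toOuterMeasure_apply_fintype]
  calc _ ≤ ∑ _q : Q, ENNReal.ofReal (Real.exp (-(ε * ξ * n / 2))) := by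
        refine Finset.sum_le_sum fun q _ => ?_
        refine Set.indicator_le' (g := fun _ => ENNReal.ofReal (Real.exp (-(ε * ξ * n / 2))))
          (fun q hq => ?_) (fun _ _ => zero_le) q
        obtain ⟨q', hq'⟩ := hq
        by_cases hΔ : sensitivity (score (n := n) Q x) ≤ 0
        · rw [score_eq_zero hn hs x hΔ, score_eq_zero hn hs x hΔ] at hq'
          linarith
        · rw [not_le] at hΔ
          have hΔ1 := sensitivity_score_le (n := n) Q x
          set Δ := sensitivity (score (n := n) Q x) with hΔdef
          rw [expMechanism_apply]
          -- The normalizer is at least the weight of the better query `q'` alone.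
          calc _ ≤ expWeight (score Q x) ε D q * (expWeight (score Q x) ε D q')⁻¹ := by
                gcongr
                exact Finset.single_le_sum (f := fun r => expWeight (score Q x) ε D r)
                  (fun _ _ => zero_le) (Finset.mem_univ q')
            _ ≤ _ := by
                unfold expWeight
                rw [← ENNReal.ofReal_inv_of_pos (Real.exp_pos _),
                  ← ENNReal.ofReal_mul (Real.exp_pos _).le, ← Real.exp_neg, ← Real.exp_add]
                refine ENNReal.ofReal_le_ofReal (Real.exp_le_exp.2 ?_)
                rw [← hΔdef, ← sub_eq_add_neg, ← sub_div, ← mul_sub, div_le_iff₀ (by positivity)]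
                have h1 : ε * (score Q x D q - score Q x D q') ≤ ε * (-ξ) :=
                  mul_le_mul_of_nonneg_left (by linarith) hε.le
                have h2 : n * Δ ≤ 1 := by
                  rw [le_div_iff₀ hn0] at hΔ1; linarith
                have h3 : ε * ξ * (n * Δ) ≤ ε * ξ * 1 :=
                  mul_le_mul_of_nonneg_left h2 (by positivity)
                linarith
    _ = _ := by
        rw [Finset.sum_const, nsmul_eq_mul, ENNReal.ofReal_mul (Nat.cast_nonneg _),
          ENNReal.ofReal_natCast, Finset.card_univ, Fintype.card_coe]

/-- The union bound for two-stage sampling, with `A` the failures of the first stage. -/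
theorem toOuterMeasure_bind_le {Y Z : Type*} (P : PMF Y) (k : Y → PMF Z) (A : Set Y) (B : Set Z)
    {c : ℝ≥0∞} (h : ∀ y, y ∉ A → (k y).toOuterMeasure B ≤ c) :
    (P.bind k).toOuterMeasure B ≤ P.toOuterMeasure A + c := by
  rw [PMF.toOuterMeasure_bind_apply, PMF.toOuterMeasure_apply]
  calc _ ≤ ∑' y, (A.indicator P y + P y * c) := by
        refine ENNReal.tsum_le_tsum fun y => ?_
        by_cases hy : y ∈ A
        · rw [Set.indicator_of_mem hy]
          refine le_trans ?_ le_self_add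
          have h1 : (k y).toOuterMeasure B ≤ 1 :=
            ((k y).toOuterMeasure.mono (Set.subset_univ B)).trans (by
              simp [PMF.toOuterMeasure_apply, (k y).tsum_coe])
          exact mul_le_of_le_one_right zero_le h1
        · rw [Set.indicator_of_notMem hy, zero_add]
          gcongr
          exact h y hy
    _ = _ := by rw [ENNReal.tsum_add, ENNReal.tsum_mul_right, P.tsum_coe, one_mul]

/-- The history of a run in which, in every round, the empirical answer to the selected query is at
most `τ` below its expectation and the selected query is optimal up to `ξ`. -/
def GoodHistory {X : Type*} [Fintype X] [DecidableEq X] {n : ℕ} (O : ArgmaxOracle X)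
    (Q : Finset (X → Bool)) (S : Finset (X → Bool)) (η τ ξ : ℝ) {s : ℕ} (D : Fin n → X) :
    List Q → List (Fin s → X) → Prop
  | [], _ => False
  | _ :: qs, [] => qs = []
  | q :: qs, x :: xs => GoodHistory O Q S η τ ξ D qs xs ∧
      expAnswer (ftpl O S η (qs.map Subtype.val)) q.1 - τ ≤ answerDist q.1 (empirical x) ∧
      ∀ q', score Q x D q' ≤ score Q x D q + ξ

/-- The query is selected after the batch is seen, so concentration is needed simultaneously for all
of `Q`. Each round adds one sampling failure and one selection failure. -/
theorem transcript_bad_le {X : Type*} [Fintype X] [DecidableEq X] {n s : ℕ} (O : ArgmaxOracle X)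
    {Q : Finset (X → Bool)} [Nonempty Q] (S : Finset (X → Bool)) {ε η τ ξ γ₁ γ₂ : ℝ} (hn : 1 ≤ n)
    (hs : 1 ≤ s) (hε : 0 < ε) (hξ : 0 ≤ ξ) (hτ0 : 0 < τ) (hτ1 : τ ≤ 1)
    (hγ₁ : Q.card * Real.exp (-(s * τ ^ 2 / 4)) ≤ γ₁)
    (hγ₂ : Q.card * Real.exp (-(ε * ξ * n / 2)) ≤ γ₂) (D : Fin n → X) (t : ℕ) :
    (transcript O Q S ε η s D t).toOuterMeasure
        {h | ¬(GoodHistory O Q S η τ ξ D h.1 h.2 ∧ h.2.length = t)} ≤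
      t * (ENNReal.ofReal γ₁ + ENNReal.ofReal γ₂) := by
  induction t with
  | zero =>
    rw [transcript, PMF.toOuterMeasure_map_apply]
    have : ((fun q : Q => ([q], ([] : List (Fin s → X)))) ⁻¹'
        {h | ¬(GoodHistory O Q S η τ ξ D h.1 h.2 ∧ h.2.length = 0)}) = ∅ := by
      ext q
      simp [GoodHistory]
    rw [this]
    simp
  | succ t ih =>
    rw [transcript]
    refine (toOuterMeasure_bind_le (c := ENNReal.ofReal γ₁ + ENNReal.ofReal γ₂) _ _ _ _
      fun h hh => ?_).trans ((add_le_add_left ih _).trans (le_of_eq ?_))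
    · rw [Set.mem_ofPred_eq, not_not] at hh
      refine (toOuterMeasure_bind_le _ _ {x | ∃ q ∈ Q, answerDist q (empirical x) <
        expAnswer (ftpl O S η (h.1.map Subtype.val)) q - τ} _ fun x hx => ?_).trans
          (add_le_add_left ((iid_exists_tail_le _ Q hs hτ0 hτ1).trans
            (ENNReal.ofReal_le_ofReal hγ₁)) _)
      rw [PMF.toOuterMeasure_map_apply]
      refine le_trans ((expMechanism _ _ _).toOuterMeasure.mono fun q hq => ?_)
        ((expMechanism_tail_le hn hs x hε hξ D).trans (ENNReal.ofReal_le_ofReal hγ₂))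
      simp only [Set.mem_ofPred_eq, not_exists, not_and, not_lt] at hx
      by_contra hcon
      simp only [Set.mem_ofPred_eq, not_exists, not_lt] at hcon
      refine hq ⟨⟨hh.1, hx q.1 q.2, hcon⟩, ?_⟩
      rw [List.length_cons, hh.2]
    · push_cast
      ring

/-- The selected query's score nearly dominates that of `q'`, and its empirical answer is nearly its
expectation. The initial query `q_0` has no batch, but it does enter `followerSum`; this costs the
summand 1. -/
theorem GoodHistory.sum_le {X : Type*} [Fintype X] [DecidableEq X] {n s : ℕ} {O : ArgmaxOracle X}
    {Q : Finset (X → Bool)} {S : Finset (X → Bool)} {η τ ξ : ℝ} {D : Fin n → X}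
    {qs : List Q} {xs : List (Fin s → X)} (hn : 1 ≤ n) (h : GoodHistory O Q S η τ ξ D qs xs)
    (q' : Q) :
    (xs.map fun x => score Q x D q').sum ≤
      (qs.map fun q => answer q.1 D).sum - followerSum O S η (qs.map Subtype.val) + 1 +
        xs.length * (ξ + τ) ∧ qs.length = xs.length + 1 := by
  have hn0 : (n : ℝ) ≠ 0 := by positivity
  induction xs generalizing qs with
  | nil =>
    match qs, h with
    | [q], _ =>
      have h1 := expAnswer_le_one (ftpl O S η []) q.1
      have h2 : 0 ≤ answer q.1 D := by unfold answer; positivity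
      simp [followerSum]
      linarith
    | _ :: _ :: _, h => simp [GoodHistory] at h
  | cons x xs ih =>
    match qs, h with
    | q :: qs, h =>
      obtain ⟨h1, h2, h3⟩ := h
      obtain ⟨i1, i2⟩ := ih h1
      have h4 := h3 q'
      have h5 : score Q x D q = answer q.1 D - answerDist q.1 (empirical x) := rfl
      simp only [List.map_cons, List.sum_cons, followerSum, List.length_cons, i2]
      push_cast
      exact ⟨by linarith, trivial⟩

/-- A dataset's answers are averages over its records, so regret against single records suffices. -/
theorem sum_answer_le {X : Type*} {n : ℕ} (hn : 1 ≤ n) (D : Fin n → X) (qs : List (X → Bool))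
    {c : ℝ} (h : ∀ x, (qs.map fun q => ((q x).toNat : ℝ)).sum ≤ c) :
    (qs.map fun q => answer q D).sum ≤ c := by
  have hn0 : (0 : ℝ) < n := by exact_mod_cast hn
  have e : ∀ qs : List (X → Bool), (qs.map fun q => answer q D).sum =
      (∑ i, (qs.map fun q => ((q (D i)).toNat : ℝ)).sum) / n := fun qs => by
    induction qs with
    | nil => simp
    | cons q qs ih =>
      simp only [List.map_cons, List.sum_cons, Finset.sum_add_distrib, add_div, ih]
      rfl
  rw [e, div_le_iff₀ hn0]
  refine (Finset.sum_le_sum fun i _ => h (D i)).trans (le_of_eq ?_)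
  simp [mul_comm]

theorem answerDist_average {X : Type*} [Fintype X] [DecidableEq X] {s : ℕ} (q : X → Bool)
    (xs : List (Fin s → X)) (T : ℝ) :
    answerDist q (fun y => (xs.map fun x => empirical x y).sum / T) =
      (xs.map fun x => answerDist q (empirical x)).sum / T := by
  have e : ∀ y, (xs.map fun x => empirical x y).sum / T * ((q y).toNat : ℝ) =
      (xs.map fun x => empirical x y).sum * ((q y).toNat : ℝ) / T := fun y => by ring
  simp only [answerDist, e, ← Finset.sum_div]
  congr 1
  induction xs with
  | nil => simp
  | cons x xs ih =>
    simp only [List.map_cons, List.sum_cons, add_mul, Finset.sum_add_distrib] at ih ⊢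
    rw [ih fun y => by ring]

theorem sum_average {X : Type*} [Fintype X] [DecidableEq X] {s : ℕ} (hs : 1 ≤ s)
    {xs : List (Fin s → X)} {T : ℕ} (hT : 1 ≤ T) (h : xs.length = T) :
    ∑ y, (xs.map fun x => empirical x y).sum / (T : ℝ) = 1 := by
  have hT0 : (T : ℝ) ≠ 0 := by positivity
  have h1 := answerDist_average (fun _ : X => true) xs T
  simp only [answerDist, Bool.toNat_true, Nat.cast_one, mul_one] at h1
  rw [h1]
  simp only [sum_empirical hs]
  simp [h, hT0]

/-- The accuracy of `sepFEM` in terms of its parameters. -/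
theorem accurateWithProb_sepFEM {X : Type*} [Fintype X] [DecidableEq X] {n s T : ℕ}
    (O : ArgmaxOracle X) {Q : Finset (X → Bool)} [Nonempty Q] {S : Finset (X → Bool)}
    (hQ : NegClosed Q) (hS : IsSeparator S) (hS0 : 0 < S.card) (hn : 1 ≤ n) (hT : 1 ≤ T)
    (hs : 1 ≤ s) {ρ η τ ξ α β : ℝ} (hρ : 0 < ρ) (hη : 0 < η) (hξ : 0 ≤ ξ) (hτ0 : 0 < τ)
    (hτ1 : τ ≤ 1) (hβ : 0 < β)
    (hγ₁ : Q.card * Real.exp (-(s * τ ^ 2 / 4)) ≤ β / (2 * T))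
    (hγ₂ : Q.card * Real.exp (-(Real.sqrt (2 * (ρ / T)) * ξ * n / 2)) ≤ β / (2 * T))
    (hα : 1 + T * (ξ + τ) + (T + 1) * (2 * S.card / η) +
      4 * η * Real.sqrt S.card * (Real.log (2 * Fintype.card X) + 1 / 2) ≤ T * α)
    (D : Fin n → X) : AccurateWithProb (sepFEM O Q S ρ T η s) Q D α β := by
  have hT0 : (0 : ℝ) < T := by exact_mod_cast hT
  have hbad := transcript_bad_le O S (η := η) hn hs
    (Real.sqrt_pos.2 (by positivity : 0 < 2 * (ρ / T))) hξ hτ0 hτ1 hγ₁ hγ₂ D T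
  rw [← ENNReal.ofReal_add (by positivity) (by positivity), ← ENNReal.ofReal_natCast,
    ← ENNReal.ofReal_mul (by positivity)] at hbad
  have e1 : (T : ℝ) * (β / (2 * T) + β / (2 * T)) = β := by field_simp; norm_num
  rw [e1] at hbad
  unfold AccurateWithProb sepFEM
  rw [PMF.toOuterMeasure_map_apply]
  set P := transcript O Q S (Real.sqrt (2 * (ρ / T))) η s D T
  set B := {h : List Q × List (Fin s → X) |
    ¬(GoodHistory O Q S η τ ξ D h.1 h.2 ∧ h.2.length = T)}
  have hgood : 1 - ENNReal.ofReal β ≤ P.toOuterMeasure Bᶜ := by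
    rw [tsub_le_iff_right]
    calc (1 : ℝ≥0∞) = P.toOuterMeasure (Bᶜ ∪ B) := by
          rw [Set.compl_union_self]
          simp [PMF.toOuterMeasure_apply, P.tsum_coe]
      _ ≤ _ := (measure_union_le _ _).trans (by gcongr)
  rw [ENNReal.ofReal_sub _ hβ.le, ENNReal.ofReal_one]
  refine hgood.trans (P.toOuterMeasure.mono fun h hh => ?_)
  rw [Set.mem_compl_iff, Set.mem_ofPred_eq, not_not] at hh
  obtain ⟨hh, hlen⟩ := hh
  have key : ∀ q ∈ Q, answer q D - answerDist q
      (fun y => (h.2.map fun x => empirical x y).sum / (T : ℝ)) ≤ α := fun q hq => by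
    obtain ⟨h1, h2⟩ := hh.sum_le hn ⟨q, hq⟩
    have h3 := sum_answer_le hn D (h.1.map Subtype.val) (regret_le O hS hS0 hη _)
    rw [List.map_map] at h3
    rw [List.length_map, h2, hlen] at h3
    have h4 : (h.2.map fun x => score Q x D ⟨q, hq⟩).sum =
        T * answer q D - (h.2.map fun x => answerDist q (empirical x)).sum := by
      rw [← hlen]
      generalize h.2 = xs
      induction xs with
      | nil => simp
      | cons x xs ih =>
        simp only [List.map_cons, List.sum_cons, ih, List.length_cons]
        push_cast
        simp only [score]
        ring
    rw [h4, hlen] at h1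
    rw [answerDist_average, sub_le_iff_le_add, ← mul_le_mul_iff_right₀ hT0, mul_add,
      mul_div_cancel₀ _ hT0.ne']
    push_cast at h3
    simp only [Function.comp_def] at h3
    linarith
  intro q hq
  rw [abs_le]
  refine ⟨?_, key q hq⟩
  -- The one-sided bound for the negated query is the missing side for `q`, as the output has total
  -- mass 1.
  have h1 := key _ (hQ q hq)
  rw [answer_not hn, answerDist_not q (sum_average hs hT hlen)] at h1
  linarith

/-! ### Choice of the parameters -/

theorem AccurateWithProb.mono {X : Type*} [Fintype X] {n : ℕ} {M : (Fin n → X) → PMF (X → ℝ)}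
    {Q : Finset (X → Bool)} {D : Fin n → X} {α α' β : ℝ} (h : AccurateWithProb M Q D α β)
    (hα : α ≤ α') : AccurateWithProb M Q D α' β :=
  le_trans h ((M D).toOuterMeasure.mono fun _ hw q hq => (hw q hq).trans hα)

theorem length_of_mem_support {X : Type*} [Fintype X] [DecidableEq X] {n s : ℕ}
    (O : ArgmaxOracle X) {Q : Finset (X → Bool)} [Nonempty Q] (S : Finset (X → Bool)) (ε η : ℝ)
    (D : Fin n → X) (t : ℕ) {h : List Q × List (Fin s → X)}
    (hh : h ∈ (transcript O Q S ε η s D t).support) : h.2.length = t := by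
  induction t generalizing h with
  | zero =>
    rw [transcript, PMF.mem_support_map_iff] at hh
    obtain ⟨q, _, rfl⟩ := hh
    rfl
  | succ t ih =>
    rw [transcript, PMF.mem_support_bind_iff] at hh
    obtain ⟨h', hh', hh⟩ := hh
    rw [PMF.mem_support_bind_iff] at hh
    obtain ⟨x, _, hh⟩ := hh
    rw [PMF.mem_support_map_iff] at hh
    obtain ⟨q, _, rfl⟩ := hh
    rw [List.length_cons, ih hh']

/-- An error bound valid for all distributions is valid for the output of `sepFEM`. -/
theorem accurateWithProb_of_forall {X : Type*} [Fintype X] [DecidableEq X] {n s T : ℕ}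
    (O : ArgmaxOracle X) {Q : Finset (X → Bool)} [Nonempty Q] (S : Finset (X → Bool)) (ρ η : ℝ)
    (hT : 1 ≤ T) (hs : 1 ≤ s) {α β : ℝ} (hβ : 0 < β) (D : Fin n → X)
    (h : ∀ w : X → ℝ, (∀ x, 0 ≤ w x) → ∑ x, w x = 1 → ∀ q ∈ Q,
      |answer q D - answerDist q w| ≤ α) :
    AccurateWithProb (sepFEM O Q S ρ T η s) Q D α β := by
  unfold AccurateWithProb
  have h1 : (sepFEM O Q S ρ T η s D).toOuterMeasure
      {w | ∀ q ∈ Q, |answer q D - answerDist q w| ≤ α} = 1 := by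
    rw [PMF.toOuterMeasure_apply_eq_one_iff]
    intro w hw
    rw [sepFEM, PMF.mem_support_map_iff] at hw
    obtain ⟨hist, hh, rfl⟩ := hw
    refine h _ (fun y => div_nonneg (List.sum_nonneg fun v hv => ?_) (Nat.cast_nonneg _))
      (sum_average hs hT (length_of_mem_support O S _ η D T hh))
    obtain ⟨x, _, rfl⟩ := List.mem_map.1 hv
    exact empirical_nonneg x y
  rw [h1, ← ENNReal.ofReal_one]
  exact ENNReal.ofReal_le_ofReal (by linarith)

theorem answer_mem_Icc {X : Type*} {n : ℕ} (q : X → Bool) (D : Fin n → X) :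
    answer q D ∈ Set.Icc (0 : ℝ) 1 := by
  unfold answer
  refine ⟨by positivity, div_le_one_of_le₀ ?_ (Nat.cast_nonneg _)⟩
  calc ∑ i, ((q (D i)).toNat : ℝ) ≤ ∑ _i : Fin n, (1 : ℝ) :=
        Finset.sum_le_sum fun i _ => by cases q (D i) <;> simp
    _ = n := by simp

theorem two_le_card_of_negClosed {X : Type*} [Nonempty X] {Q : Finset (X → Bool)} [Nonempty Q]
    (hQ : NegClosed Q) : 2 ≤ Q.card := by
  obtain ⟨q, hq⟩ := (inferInstance : Nonempty Q)
  refine Finset.one_lt_card.2 ⟨q, hq, _, hQ q hq, fun h => ?_⟩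
  have x : X := Classical.arbitrary X
  have := congrFun h x
  revert this
  cases q x <;> simp

theorem one_le_dim {X : Type*} [Fintype X] (h : 2 ≤ Fintype.card X) : 1 ≤ dim X := by
  unfold dim
  rw [Real.le_logb_iff_rpow_le (by norm_num) (by positivity), Real.rpow_one]
  exact_mod_cast h

theorem log_card_le_dim {X : Type*} [Fintype X] (h : 2 ≤ Fintype.card X) :
    Real.log (2 * Fintype.card X) + 1 / 2 ≤ 2 * dim X := by
  have h1 := one_le_dim h
  have hX : (0 : ℝ) < Fintype.card X := by
    have : 0 < Fintype.card X := by omega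
    exact_mod_cast this
  have h2 : Real.log (Fintype.card X) = dim X * Real.log 2 := by
    unfold dim Real.logb
    have := (Real.log_pos (by norm_num : (1 : ℝ) < 2)).ne'
    field_simp
  rw [Real.log_mul (by norm_num) hX.ne', h2]
  have h3 := Real.log_two_lt_d9
  nlinarith

theorem card_pos_of_isSeparator {X : Type*} [Fintype X] (h : 2 ≤ Fintype.card X)
    {S : Finset (X → Bool)} (hS : IsSeparator S) : 0 < S.card := by
  obtain ⟨x, x', hne⟩ := Fintype.one_lt_card_iff.1 h
  obtain ⟨q, hq, _⟩ := hS x x' hne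
  exact Finset.card_pos.2 ⟨q, hq⟩

/-- The error of `sepFEM` up to logarithmic factors, with `L = log (|Q| / β)`. -/
noncomputable def errorRate (N d n ρ L : ℝ) : ℝ :=
  N ^ (3 / 8 : ℝ) * d ^ (1 / 4 : ℝ) * Real.sqrt L / (ρ ^ (1 / 4 : ℝ) * n ^ (1 / 2 : ℝ))

theorem errorRate_sq {N d n ρ L : ℝ} (hN : 0 ≤ N) (hd : 0 ≤ d) (hn : 0 ≤ n) (hρ : 0 ≤ ρ)
    (hL : 0 ≤ L) :
    errorRate N d n ρ L ^ 2 =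
      (N ^ (1 / 4 : ℝ)) ^ 3 * Real.sqrt d * L / (Real.sqrt ρ * n) := by
  unfold errorRate
  rw [div_pow, mul_pow, mul_pow, mul_pow, Real.sq_sqrt hL]
  simp only [← Real.rpow_natCast, ← Real.rpow_mul hN, ← Real.rpow_mul hd, ← Real.rpow_mul hn,
    ← Real.rpow_mul hρ, Real.sqrt_eq_rpow]
  norm_num

/-- The number of rounds is polynomial in the parameters: `T ≤ 2 M √ρ n / L`, and with `y` the
argument of the logarithm, `2 T ≤ 8 y⁴ ≤ y⁷`. -/
theorem log_rounds_le {T M n ρ G L N d : ℝ} (hL : 1 / 2 ≤ L) (hN : 1 ≤ N) (hd : 1 ≤ d)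
    (hn : 1 ≤ n) (hρ : 0 < ρ) (hG : 0 < G) (hT : 1 ≤ T) (hM0 : 0 < M) (hM : M ≤ N * d)
    (hG2 : G ^ 2 * (Real.sqrt ρ * n) = M * L) (hTle : T ≤ 2 * (M / G) ^ 2) :
    Real.log (2 * T) ≤ 7 * Real.log (Real.exp 1 + (n + N + d + ρ)) := by
  set y := Real.exp 1 + (n + N + d + ρ) with hy
  have he := Real.add_one_le_exp (1 : ℝ)
  have hsρ : Real.sqrt ρ ≤ 1 + ρ := by
    rw [Real.sqrt_le_iff]; constructor <;> nlinarith
  have hsρ0 : 0 < Real.sqrt ρ := Real.sqrt_pos.2 hρ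
  have h1 : (M / G) ^ 2 = M * (Real.sqrt ρ * n) / L := by
    rw [div_pow, div_eq_div_iff (by positivity) (by positivity)]
    linear_combination -M * hG2
  have h2 : M * (Real.sqrt ρ * n) / L ≤ 2 * (M * (Real.sqrt ρ * n)) := by
    rw [div_le_iff₀ (by linarith)]
    have : 0 < M * (Real.sqrt ρ * n) := by positivity
    nlinarith
  have h3 : M * (Real.sqrt ρ * n) ≤ (y * y) * (y * y) := by
    have a1 : N * d ≤ y * y := by gcongr <;> linarith
    have a2 : Real.sqrt ρ * n ≤ y * y := by gcongr <;> linarith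
    have a3 : M ≤ y * y := hM.trans a1
    gcongr
  have h4 : 2 * T ≤ y ^ 7 := by
    have h5 : (2 : ℝ) ^ 3 ≤ y ^ 3 := by gcongr; linarith
    calc 2 * T ≤ 2 ^ 3 * (y * y * (y * y)) := by linarith
      _ ≤ y ^ 3 * (y * y * (y * y)) := by gcongr
      _ = y ^ 7 := by ring
  calc Real.log (2 * T) ≤ Real.log (y ^ 7) := Real.log_le_log (by linarith) h4
    _ = _ := by rw [Real.log_pow]; norm_num

theorem one_le_log_exp_add {y : ℝ} (hy : 0 ≤ y) : 1 ≤ Real.log (Real.exp 1 + y) := by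
  rw [Real.le_log_iff_exp_le (by positivity)]
  linarith

/-- The selection error grows with `t = √T` because `ε` is proportional to `1 / t`. The balance
equation `hG2` and the upper bound on `t` bring it down to `G` up to the logarithm. -/
theorem selection_error_le {t ε ρ n L L' M G y : ℝ} (hn : 1 ≤ n) (hM : 0 < M) (hG0 : 0 < G)
    (hε0 : 0 < ε) (hy : 0 ≤ y) (hL'le : L' ≤ 15 * y * L) (hG2 : G ^ 2 * (Real.sqrt ρ * n) = M * L)
    (htle : t ≤ Real.sqrt 2 * (M / G)) (hεt : ε * t = Real.sqrt 2 * Real.sqrt ρ) :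
    2 * L' / (ε * n) ≤ 30 * y * G := by
  rw [div_le_iff₀ (by positivity)]
  have h2 : Real.sqrt 2 * Real.sqrt 2 = 2 := Real.mul_self_sqrt (by norm_num)
  have h2p : 0 < Real.sqrt 2 := by positivity
  have h1 : Real.sqrt ρ * G ≤ ε * M := by
    have a1 : Real.sqrt 2 * Real.sqrt ρ ≤ ε * (Real.sqrt 2 * (M / G)) := by
      rw [← hεt]; gcongr
    have a2 : ε * (Real.sqrt 2 * (M / G)) = Real.sqrt 2 * (ε * M / G) := by ring
    rw [a2] at a1
    have a3 := le_of_mul_le_mul_left a1 h2p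
    rwa [le_div_iff₀ hG0] at a3
  have h3 : L * M ≤ G * (ε * n) * M := by
    calc L * M = G * n * (Real.sqrt ρ * G) := by linear_combination -hG2
      _ ≤ G * n * (ε * M) := by gcongr
      _ = _ := by ring
  have h4 : L ≤ G * (ε * n) := le_of_mul_le_mul_right h3 (by linarith)
  calc 2 * L' ≤ 2 * (15 * y * L) := by linarith
    _ = 30 * y * L := by ring
    _ ≤ 30 * y * (G * (ε * n)) := by gcongr
    _ = _ := by ring

/-- In use `t = √T`, `r = |S|^(1/4)`, `w = √d` and `η = t r / w`, which makes both the stability and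
the noise terms of order `t M`. The constant is `44 = 30 + 1 + 1 + 4 + 8`: selection, initial query,
sampling, stability, noise. -/
theorem total_error_le {t r w M G y ξ K : ℝ} (ht1 : 1 ≤ t) (hr1 : 1 ≤ r) (hw1 : 1 ≤ w)
    (hM : M = r ^ 3 * w) (hG0 : 0 < G) (hy1 : 1 ≤ y) (hξ : ξ ≤ 30 * y * G) (hK : K ≤ 2 * w ^ 2)
    (b4 : M ≤ t * G) :
    1 + t ^ 2 * (ξ + 1 / t) + (t ^ 2 + 1) * (2 * r ^ 4 / (t * r / w)) +
      4 * (t * r / w) * r ^ 2 * K ≤ t ^ 2 * (44 * y * G) := by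
  have hM1 : 1 ≤ M := hM ▸ one_le_mul_of_one_le_of_one_le (one_le_pow₀ hr1) hw1
  have b1 : 2 * r ^ 4 / (t * r / w) = 2 * M / t := by
    rw [hM]; field_simp
  have b2 : 4 * (t * r / w) * r ^ 2 * K ≤ 8 * t * M := by
    calc _ ≤ 4 * (t * r / w) * r ^ 2 * (2 * w ^ 2) := by gcongr
      _ = _ := by rw [hM]; field_simp; ring
  have b3 : (t ^ 2 + 1) * (2 * M / t) ≤ 4 * t * M := by
    rw [← mul_div_assoc, div_le_iff₀ (by linarith)]
    have : 1 ≤ t ^ 2 := one_le_pow₀ ht1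
    nlinarith
  have b5 : t ^ 2 * (ξ + 1 / t) = t ^ 2 * ξ + t := by field_simp
  have b6 : t ≤ t * M := le_mul_of_one_le_right (by linarith) hM1
  have b7 : t * M ≤ t ^ 2 * (y * G) := by
    have : G ≤ y * G := le_mul_of_one_le_left hG0.le hy1
    calc t * M ≤ t * (t * G) := by gcongr
      _ = t ^ 2 * G := by ring
      _ ≤ _ := by gcongr
  have b8 : t ^ 2 * ξ ≤ t ^ 2 * (30 * y * G) := by gcongr
  rw [b1, b5]
  linarith

theorem exists_accurate_of_errorRate_lt_one {X : Type*} [Fintype X] [DecidableEq X]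
    (O : ArgmaxOracle X) {Q : Finset (X → Bool)} [Nonempty Q] {S : Finset (X → Bool)} {n : ℕ}
    {ρ : ℝ} (hQ : NegClosed Q) (hS : IsSeparator S) (hX : 2 ≤ Fintype.card X) (hn : 1 ≤ n)
    (hρ : 0 < ρ) {β : ℝ} (hβ : 0 < β) (hβ1 : β < 1)
    (hG1 : errorRate S.card (dim X) n ρ (Real.log (Q.card / β)) < 1) :
    ∃ (T : ℕ) (η : ℝ) (s : ℕ), 1 ≤ T ∧ 0 < η ∧ 1 ≤ s ∧ ∀ D : Fin n → X,
      AccurateWithProb (sepFEM O Q S ρ T η s) Q D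
        (44 * Real.log (Real.exp 1 + (n + S.card + dim X + ρ)) *
          errorRate S.card (dim X) n ρ (Real.log (Q.card / β))) β := by
  have hne : Nonempty X := Fintype.card_pos_iff.1 (by omega)
  have hScard := card_pos_of_isSeparator hX hS
  have hN1 : (1 : ℝ) ≤ S.card := by exact_mod_cast hScard
  have hn1 : (1 : ℝ) ≤ n := by exact_mod_cast hn
  have hd1 := one_le_dim hX
  have hdlog := log_card_le_dim hX
  have hQ2 : (2 : ℝ) ≤ Q.card := by exact_mod_cast two_le_card_of_negClosed hQ
  set N : ℝ := (S.card : ℝ) with hN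
  set d := dim X
  have hQβ : 2 ≤ Q.card / β := by
    rw [le_div_iff₀ hβ]; linarith
  set L := Real.log (Q.card / β) with hL
  have hL2 : 1 / 2 ≤ L := by
    have := Real.log_le_log (by norm_num) hQβ
    have := Real.log_two_gt_d9
    linarith
  set G := errorRate N d n ρ L with hG
  have hsρ : 0 < Real.sqrt ρ := Real.sqrt_pos.2 hρ
  have hG0 : 0 < G := by
    have : 0 < Real.sqrt L := Real.sqrt_pos.2 (by linarith)
    rw [hG, errorRate]
    positivity
  set r := N ^ (1 / 4 : ℝ) with hr
  set w := Real.sqrt d with hw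
  have hr1 : 1 ≤ r := Real.one_le_rpow hN1 (by norm_num)
  have hw1 : 1 ≤ w := Real.one_le_sqrt.2 hd1
  have hr4 : r ^ 4 = N := by
    rw [hr, ← Real.rpow_natCast, ← Real.rpow_mul (by linarith)]; norm_num
  have hr2 : Real.sqrt N = r ^ 2 := by
    rw [Real.sqrt_eq_iff_eq_sq (by linarith) (by positivity), ← hr4]; ring
  have hw2 : w ^ 2 = d := Real.sq_sqrt (by linarith)
  set M := r ^ 3 * w with hM
  have hM1 : 1 ≤ M := one_le_mul_of_one_le_of_one_le (one_le_pow₀ hr1) hw1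
  have hMle : M ≤ N * d := by
    rw [hM, ← hr4, ← hw2]
    have : r ^ 3 ≤ r ^ 4 := pow_le_pow_right₀ hr1 (by norm_num)
    have : w ≤ w ^ 2 := by nlinarith
    gcongr
  have hG2 : G ^ 2 * (Real.sqrt ρ * n) = M * L := by
    rw [hG, errorRate_sq (by linarith) (by linarith) (by linarith) hρ.le (by linarith),
      div_mul_cancel₀ _ (by positivity)]
  have hMG : 1 < M / G := by rw [lt_div_iff₀ hG0]; linarith
  have hMG2 : 1 < (M / G) ^ 2 := one_lt_pow₀ hMG (by norm_num)
  -- This `T` balances regret against selection error. As `G < 1 ≤ M`, rounding up costs at most a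
  -- factor 2.
  obtain ⟨T, hTge, hTle⟩ : ∃ T : ℕ, (M / G) ^ 2 ≤ T ∧ (T : ℝ) ≤ 2 * (M / G) ^ 2 := by
    refine ⟨⌈(M / G) ^ 2⌉₊, Nat.le_ceil _, ?_⟩
    have := Nat.ceil_lt_add_one (a := (M / G) ^ 2) (by positivity)
    linarith
  have hT1 : (1 : ℝ) ≤ T := by linarith
  have hT1' : 1 ≤ T := by exact_mod_cast hT1
  set t := Real.sqrt T with ht
  have ht2 : t ^ 2 = T := Real.sq_sqrt (by linarith)
  have ht1 : 1 ≤ t := Real.one_le_sqrt.2 hT1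
  have htge : M / G ≤ t := Real.le_sqrt_of_sq_le hTge
  have htle : t ≤ Real.sqrt 2 * (M / G) := by
    rw [ht, Real.sqrt_le_iff]
    refine ⟨by positivity, ?_⟩
    rwa [mul_pow, Real.sq_sqrt (by norm_num)]
  clear_value M r w G t
  -- Chosen so that `|Q| exp (-L') = β / (2 T)`, the failure probability allotted to each of the two
  -- bad events in each round.
  set L' := L + Real.log (2 * T) with hL'
  have hlogT := log_rounds_le hL2 hN1 hd1 hn1 hρ hG0 hT1 (by linarith) hMle hG2 hTle
  set y := Real.log (Real.exp 1 + (n + N + d + ρ)) with hy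
  have hy1 : 1 ≤ y := one_le_log_exp_add (by positivity)
  have hlogT0 : 0 ≤ Real.log (2 * T) := Real.log_nonneg (by linarith)
  have hL'le : L' ≤ 15 * y * L := by
    have h1 := mul_le_mul_of_nonneg_left (show 1 ≤ 2 * L by linarith) (show 0 ≤ 7 * y by linarith)
    have h2 := le_mul_of_one_le_right (show 0 ≤ L by linarith) hy1
    linarith
  have hexpL' : (Q.card : ℝ) * Real.exp (-L') = β / (2 * T) := by
    rw [hL', neg_add, Real.exp_add, Real.exp_neg, Real.exp_neg, Real.exp_log (by linarith),
      Real.exp_log (by linarith)]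
    field_simp
  set ε := Real.sqrt (2 * (ρ / T)) with hε
  have hε0 : 0 < ε := Real.sqrt_pos.2 (by positivity)
  have hεt : ε * t = Real.sqrt 2 * Real.sqrt ρ := by
    rw [hε, ht, ← Real.sqrt_mul (by positivity), ← Real.sqrt_mul (by norm_num)]
    congr 1
    field_simp
  set ξ := 2 * L' / (ε * n) with hξ
  have hξ0 : 0 ≤ ξ := div_nonneg (by linarith) (by positivity)
  have hL'0 : 0 < L' := by linarith
  have hξle : ξ ≤ 30 * y * G :=
    selection_error_le hn1 (by linarith) hG0 hε0 (by linarith) hL'le hG2 htle hεt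
  -- The number of samples does not enter the error bound, so it can be taken large enough for
  -- sampling error `1 / t`.
  obtain ⟨s, hs⟩ := exists_nat_ge (4 * L' / (1 / t) ^ 2 + 1)
  have hs0 : 0 < 4 * L' / (1 / t) ^ 2 := by positivity
  have hs1 : (1 : ℝ) ≤ s := by linarith
  have hη : 0 < t * r / w := by positivity
  refine ⟨T, t * r / w, s, hT1', hη, by exact_mod_cast hs1, fun D => ?_⟩
  refine accurateWithProb_sepFEM O hQ hS hScard hn hT1' (by exact_mod_cast hs1) hρ hη hξ0
    (τ := 1 / t) (by positivity) (by rw [div_le_one (by linarith)]; exact ht1) hβ ?_ ?_ ?_ D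
  · rw [← hexpL']
    gcongr
    have : 4 * L' / (1 / t) ^ 2 ≤ s := by linarith
    rw [div_le_iff₀ (by positivity)] at this
    linarith
  · rw [← hexpL']
    have : ε * ξ * n / 2 = L' := by
      rw [hξ, mul_div_assoc']
      exact (div_eq_iff two_ne_zero).2 (by rw [div_mul_eq_mul_div, div_eq_iff (by positivity)]; ring)
    rw [this]
  · rw [← hN, hr2, ← ht2, ← hr4]
    exact total_error_le ht1 hr1 hw1 hM hG0 hy1 hξle (by rwa [hw2]) (by rwa [div_le_iff₀ hG0] at htge)

theorem polylog_one (y : ℝ) : polylog 1 y = Real.log (Real.exp 1 + y) := pow_one _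

theorem answerDist_eq_answer_of_card_le_one {X : Type*} [Fintype X] (hX : Fintype.card X ≤ 1)
    {n : ℕ} (hn : 1 ≤ n) (q : X → Bool) (D : Fin n → X) {w : X → ℝ} (hw : ∑ x, w x = 1) :
    answer q D = answerDist q w := by
  have := Fintype.card_le_one_iff_subsingleton.1 hX
  have hq : ∀ x, q x = q (D ⟨0, hn⟩) := fun x => congrArg q (Subsingleton.elim _ _)
  rw [answer_const hn hq, answerDist_const hq hw]

theorem dim_nonneg {X : Type*} [Fintype X] [Nonempty X] : 0 ≤ dim X :=
  Real.logb_nonneg (by norm_num) (by exact_mod_cast (Fintype.card_pos (α := X)))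

/-- Adds the degenerate regimes: with at most one record all distributions answer exactly, and if
the rate is at least 1 the bound exceeds the trivial error 1. -/
theorem exists_accurate {X : Type*} [Fintype X] [DecidableEq X]
    (O : ArgmaxOracle X) {Q : Finset (X → Bool)} [Nonempty Q] {S : Finset (X → Bool)} {n : ℕ}
    {ρ : ℝ} (hQ : NegClosed Q) (hS : IsSeparator S) (hn : 1 ≤ n)
    (hρ : 0 < ρ) {β : ℝ} (hβ : 0 < β) (hβ1 : β < 1) :
    ∃ (T : ℕ) (η : ℝ) (s : ℕ), 1 ≤ T ∧ 0 < η ∧ 1 ≤ s ∧ ∀ D : Fin n → X,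
      AccurateWithProb (sepFEM O Q S ρ T η s) Q D
        (44 * polylog 1 (n + S.card + dim X + ρ) *
          errorRate S.card (dim X) n ρ (Real.log (Q.card / β))) β := by
  rw [polylog_one]
  have hne : Nonempty X := ⟨O.pick 0⟩
  rcases le_or_gt (Fintype.card X) 1 with hX | hX
  · refine ⟨1, 1, 1, le_rfl, one_pos, le_rfl, fun D => ?_⟩
    refine accurateWithProb_of_forall O S ρ 1 le_rfl le_rfl hβ D fun w _ hw q _ => ?_
    rw [answerDist_eq_answer_of_card_le_one hX hn q D hw, sub_self, abs_zero]
    have := dim_nonneg (X := X)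
    have := one_le_log_exp_add (y := n + S.card + dim X + ρ) (by positivity)
    unfold errorRate
    positivity
  · by_cases hG : errorRate S.card (dim X) n ρ (Real.log (Q.card / β)) < 1
    · exact exists_accurate_of_errorRate_lt_one O hQ hS hX hn hρ hβ hβ1 hG
    · refine ⟨1, 1, 1, le_rfl, one_pos, le_rfl, fun D => ?_⟩
      refine accurateWithProb_of_forall O S ρ 1 le_rfl le_rfl hβ D fun w hw0 hw q _ => ?_
      have := dim_nonneg (X := X)
      have h1 := one_le_log_exp_add (y := n + S.card + dim X + ρ) (by positivity)
      have h2 := answer_mem_Icc q D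
      have h3 := answerDist_nonneg q hw0
      have h4 := answerDist_le_one q hw0 hw
      rw [not_lt] at hG
      refine (abs_le.2 ⟨by linarith [h2.1], by linarith [h2.2]⟩ : _ ≤ (1 : ℝ)).trans ?_
      nlinarith

/-! ### The bounds in terms of approximate differential privacy -/

/-- The constant of the accuracy bound in terms of `(ε, δ)`. -/
noncomputable def approxConst (δ₀ : ℝ) : ℝ :=
  88 * Real.sqrt (1 / Real.log (1 / δ₀) + 2 / Real.sqrt (Real.log (1 / δ₀)))

/-- The constant of the accuracy bound for separator sets of size `O(d)`. -/
noncomputable def linearConst (c δ₀ β₀ : ℝ) : ℝ :=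
  approxConst δ₀ * (1 + Real.log (1 + c)) * c ^ (3 / 8 : ℝ) *
    Real.sqrt (1 / Real.log (1 / β₀) + 2)

/-- Since `ε < 1` forces `ρ ≤ 1`, also `ρ ≤ √ρ` and `ε ≤ √ρ (1 + 2 √l)`; the lower bound `l₀ ≤ l`
absorbs `1 + 2 √l` into a multiple of `l`. -/
theorem sqrt_eps_le {ρ l l₀ ε : ℝ} (hρ : 0 < ρ) (hl₀ : 0 < l₀) (hl : l₀ ≤ l)
    (hε : ε = ρ + 2 * Real.sqrt (ρ * l)) (hε1 : ε < 1) :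
    ε ^ (1 / 2 : ℝ) ≤
      Real.sqrt (1 / l₀ + 2 / Real.sqrt l₀) * (Real.sqrt l * ρ ^ (1 / 4 : ℝ)) := by
  have hl0 : 0 < l := hl₀.trans_le hl
  have hρ1 : ρ ≤ 1 := by
    have := Real.sqrt_nonneg (ρ * l)
    linarith
  set a := Real.sqrt l₀ with ha
  set b := Real.sqrt l with hb
  have ha0 : 0 < a := Real.sqrt_pos.2 hl₀
  have hab : a ≤ b := Real.sqrt_le_sqrt hl
  have hb2 : b ^ 2 = l := Real.sq_sqrt hl0.le
  have ha2 : a ^ 2 = l₀ := Real.sq_sqrt hl₀.le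
  have hρ4 : ρ ^ (1 / 4 : ℝ) = Real.sqrt (Real.sqrt ρ) := by
    rw [Real.sqrt_eq_rpow, Real.sqrt_eq_rpow, ← Real.rpow_mul hρ.le]; norm_num
  rw [← Real.sqrt_eq_rpow, hρ4, hb, ← Real.sqrt_mul hl0.le, ← Real.sqrt_mul (by positivity)]
  refine Real.sqrt_le_sqrt ?_
  rw [hε, Real.sqrt_mul hρ.le, ← hb]
  have h1 : ρ ≤ Real.sqrt ρ := Real.le_sqrt_of_sq_le (by nlinarith)
  have h2 : 1 + 2 * b ≤ (1 / l₀ + 2 / a) * l := by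
    have e1 : 1 ≤ 1 / l₀ * l := by
      rw [one_div_mul_eq_div, le_div_iff₀ hl₀]; linarith
    have e2 : 2 * b ≤ 2 / a * l := by
      rw [div_mul_eq_mul_div, le_div_iff₀ ha0, ← hb2]; nlinarith
    linarith
  calc ρ + 2 * (Real.sqrt ρ * b) ≤ Real.sqrt ρ * (1 + 2 * b) := by linarith
    _ ≤ Real.sqrt ρ * ((1 / l₀ + 2 / a) * l) := by gcongr
    _ = _ := by ring

theorem approx_bound_le {N d n ρ L δ₀ δ ε : ℝ} (hN : 0 ≤ N) (hd : 0 ≤ d) (hn : 0 ≤ n)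
    (hρ : 0 < ρ) (hδ : 0 < δ) (hδδ : δ ≤ δ₀) (hδ₀ : δ₀ < 1)
    (hε : ε = ρ + 2 * Real.sqrt (ρ * Real.log (1 / δ))) (hε1 : ε < 1) :
    44 * polylog 1 (n + N + d + ρ) * errorRate N d n ρ L ≤
      approxConst δ₀ * polylog 1 (n + N + d) *
        (N ^ (3 / 8 : ℝ) * d ^ (1 / 4 : ℝ) * Real.sqrt (L * Real.log (1 / δ)) /
          (ε ^ (1 / 2 : ℝ) * n ^ (1 / 2 : ℝ))) := by
  have hδ₀0 : 0 < δ₀ := hδ.trans_le hδδ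
  set l₀ := Real.log (1 / δ₀) with hl₀def
  set l := Real.log (1 / δ) with hldef
  have hl₀ : 0 < l₀ := Real.log_pos (by rw [lt_div_iff₀ hδ₀0]; linarith)
  have hl : l₀ ≤ l := Real.log_le_log (by positivity) (by gcongr)
  have hsq := Real.sqrt_nonneg (ρ * l)
  have hε0 : 0 < ε := by linarith
  have hρ1 : ρ ≤ 1 := by linarith
  have h1 := sqrt_eps_le hρ hl₀ hl hε hε1
  rw [polylog_one, polylog_one]
  set y := n + N + d with hy
  have hy0 : 0 ≤ y := by positivity
  have hylog := one_le_log_exp_add hy0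
  -- Because `ρ ≤ 1`, it can leave the logarithm at the price of a factor 2, which turns 44 into the
  -- 88 of `approxConst`.
  have h2 : Real.log (Real.exp 1 + (y + ρ)) ≤ 2 * Real.log (Real.exp 1 + y) := by
    have he := Real.add_one_le_exp (1 : ℝ)
    have e : 2 * Real.log (Real.exp 1 + y) = Real.log ((Real.exp 1 + y) ^ 2) := by
      rw [Real.log_pow]; norm_num
    rw [e]
    exact Real.log_le_log (by positivity) (by nlinarith)
  set κ := Real.sqrt (1 / l₀ + 2 / Real.sqrt l₀) with hκ
  set E := N ^ (3 / 8 : ℝ) * d ^ (1 / 4 : ℝ) * Real.sqrt L / n ^ (1 / 2 : ℝ) with hE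
  have hE0 : 0 ≤ E := by positivity
  have e1 : errorRate N d n ρ L = E * (1 / ρ ^ (1 / 4 : ℝ)) := by
    rw [errorRate, hE, mul_comm (ρ ^ (1 / 4 : ℝ)), ← div_div]
    ring
  have e2 : N ^ (3 / 8 : ℝ) * d ^ (1 / 4 : ℝ) * Real.sqrt (L * l) /
      (ε ^ (1 / 2 : ℝ) * n ^ (1 / 2 : ℝ)) = E * (Real.sqrt l / ε ^ (1 / 2 : ℝ)) := by
    rw [Real.sqrt_mul' _ (by linarith), hE, mul_comm (ε ^ (1 / 2 : ℝ)), ← div_div]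
    ring
  have h3 : 1 / ρ ^ (1 / 4 : ℝ) ≤ κ * (Real.sqrt l / ε ^ (1 / 2 : ℝ)) := by
    rw [← mul_div_assoc, div_le_div_iff₀ (by positivity) (by positivity)]
    linarith
  rw [e1, e2]
  calc 44 * Real.log (Real.exp 1 + (y + ρ)) * (E * (1 / ρ ^ (1 / 4 : ℝ)))
      ≤ 44 * (2 * Real.log (Real.exp 1 + y)) *
        (E * (κ * (Real.sqrt l / ε ^ (1 / 2 : ℝ)))) := by gcongr
    _ = _ := by rw [approxConst]; ring

theorem linear_bound_le {N d n l δ₀ ε c β β₀ K : ℝ} (hN : 0 ≤ N) (hd : d = 0 ∨ 1 ≤ d)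
    (hn : 0 ≤ n) (hl : 0 ≤ l) (hε : 0 < ε) (hK : 2 ≤ K)
    (hβ : 0 < β) (hc : N ≤ c * d) (hββ : β ≤ β₀) (hβ₀ : β₀ < 1) :
    approxConst δ₀ * polylog 1 (n + N + d) *
        (N ^ (3 / 8 : ℝ) * d ^ (1 / 4 : ℝ) * Real.sqrt (Real.log (K / β) * l) /
          (ε ^ (1 / 2 : ℝ) * n ^ (1 / 2 : ℝ))) ≤
      linearConst c δ₀ β₀ * polylog 1 (n + d) *
        (d ^ (5 / 8 : ℝ) * Real.log K ^ (1 / 2 : ℝ) * l ^ (1 / 2 : ℝ) *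
          Real.log (1 / β) ^ (1 / 2 : ℝ) / (ε ^ (1 / 2 : ℝ) * n ^ (1 / 2 : ℝ))) := by
  -- For `d = 0` both sides vanish, as positive powers of zero.
  rcases hd with rfl | hd
  · simp [Real.zero_rpow]
  have hd0 : 0 < d := by linarith
  have hc0 : 0 ≤ c := by
    by_contra h
    rw [not_le] at h
    have := mul_neg_of_neg_of_pos h hd0
    linarith
  have hβ₀0 : 0 < β₀ := hβ.trans_le hββ
  set v₀ := Real.log (1 / β₀) with hv₀
  set v := Real.log (1 / β) with hv
  set u := Real.log K with hu
  have hv₀0 : 0 < v₀ := Real.log_pos (by rw [lt_div_iff₀ hβ₀0]; linarith)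
  have hvv : v₀ ≤ v := Real.log_le_log (by positivity) (by gcongr)
  have hu2 : 1 / 2 ≤ u := by
    have := Real.log_le_log (by norm_num) hK
    have := Real.log_two_gt_d9
    linarith
  -- The sum `u + v` is bounded by a multiple of the product because `u ≥ 1 / 2` and `v ≥ v₀ > 0`;
  -- this is where `β ≤ β₀ < 1` is needed.
  have hLuv : Real.log (K / β) ≤ (1 / v₀ + 2) * (u * v) := by
    have e : Real.log (K / β) = u + v := by
      rw [hv, one_div, Real.log_inv, Real.log_div (by linarith) hβ.ne']; rfl
    rw [e]
    have h1 : u ≤ 1 / v₀ * (u * v) := by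
      rw [one_div_mul_eq_div, le_div_iff₀ hv₀0]
      gcongr
    nlinarith
  have h1 : Real.sqrt (Real.log (K / β) * l) ≤
      Real.sqrt (1 / v₀ + 2) * (u ^ (1 / 2 : ℝ) * l ^ (1 / 2 : ℝ) * v ^ (1 / 2 : ℝ)) := by
    rw [← Real.sqrt_eq_rpow, ← Real.sqrt_eq_rpow, ← Real.sqrt_eq_rpow,
      ← Real.sqrt_mul (by linarith), ← Real.sqrt_mul (by positivity),
      ← Real.sqrt_mul (by positivity)]
    refine Real.sqrt_le_sqrt ?_
    have := mul_le_mul_of_nonneg_right hLuv hl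
    linarith
  have h2 : N ^ (3 / 8 : ℝ) * d ^ (1 / 4 : ℝ) ≤ c ^ (3 / 8 : ℝ) * d ^ (5 / 8 : ℝ) := by
    have e : d ^ (5 / 8 : ℝ) = d ^ (3 / 8 : ℝ) * d ^ (1 / 4 : ℝ) := by
      rw [← Real.rpow_add hd0]; norm_num
    rw [e, ← mul_assoc, ← Real.mul_rpow hc0 hd0.le]
    gcongr
  have h3 : Real.log (Real.exp 1 + (n + N + d)) ≤
      (1 + Real.log (1 + c)) * Real.log (Real.exp 1 + (n + d)) := by
    have hy := one_le_log_exp_add (y := n + d) (by positivity)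
    have hc1 : 0 ≤ Real.log (1 + c) := Real.log_nonneg (by linarith)
    have he : 0 < Real.exp 1 := Real.exp_pos 1
    calc _ ≤ Real.log ((1 + c) * (Real.exp 1 + (n + d))) := by
          refine Real.log_le_log (by positivity) ?_
          have : 0 ≤ c * (Real.exp 1 + n) := by positivity
          linarith
      _ = Real.log (1 + c) + Real.log (Real.exp 1 + (n + d)) :=
          Real.log_mul (by positivity) (by positivity)
      _ ≤ _ := by nlinarith
  rw [polylog_one, polylog_one, linearConst]
  have hA : 0 ≤ approxConst δ₀ := by unfold approxConst; positivity
  have hlog0 := one_le_log_exp_add (y := n + d) (by positivity)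
  have hc1 : 0 ≤ Real.log (1 + c) := Real.log_nonneg (by linarith)
  calc _ ≤ approxConst δ₀ * ((1 + Real.log (1 + c)) * Real.log (Real.exp 1 + (n + d))) *
        ((c ^ (3 / 8 : ℝ) * d ^ (5 / 8 : ℝ)) * (Real.sqrt (1 / v₀ + 2) *
          (u ^ (1 / 2 : ℝ) * l ^ (1 / 2 : ℝ) * v ^ (1 / 2 : ℝ))) /
            (ε ^ (1 / 2 : ℝ) * n ^ (1 / 2 : ℝ))) := by gcongr
    _ = _ := by ring

theorem dim_eq_zero_or_one_le {X : Type*} [Fintype X] [Nonempty X] : dim X = 0 ∨ 1 ≤ dim X := by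
  rcases le_or_gt (Fintype.card X) 1 with hX | hX
  · left
    have : Fintype.card X = 1 := le_antisymm hX Fintype.card_pos
    simp [dim, this]
  · exact Or.inr (one_le_dim hX)

end QueryRelease

theorem mainTheorem3 :
    ∃ (k : ℕ) (C₁ : ℝ) (C₂ : ℝ → ℝ) (C₃ : ℝ → ℝ → ℝ → ℝ),
      ∀ (X : Type*) [Fintype X] [DecidableEq X] (O : QueryRelease.ArgmaxOracle X)
        (Q : Finset (X → Bool)) [Nonempty Q] (S : Finset (X → Bool)) (n : ℕ) (ρ : ℝ),
        QueryRelease.NegClosed Q → QueryRelease.IsSeparator S → 1 ≤ n → 0 < ρ →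
        -- privacy, for every choice of the algorithm's parameters
        (∀ (T : ℕ) (η : ℝ) (s : ℕ), 1 ≤ T → 0 < η → 1 ≤ s → ∀ δ : ℝ, 0 < δ → δ < 1 →
          QueryRelease.IsDP (n := n) (QueryRelease.sepFEM O Q S ρ T η s)
            (ρ + 2 * Real.sqrt (ρ * Real.log (1 / δ))) δ) ∧
        -- accuracy, for a suitable choice of them
        ∀ β : ℝ, 0 < β → β < 1 →
          ∃ (T : ℕ) (η : ℝ) (s : ℕ), 1 ≤ T ∧ 0 < η ∧ 1 ≤ s ∧ ∀ D : Fin n → X,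
            QueryRelease.AccurateWithProb (QueryRelease.sepFEM O Q S ρ T η s) Q D
              (C₁ * QueryRelease.polylog k (n + S.card + QueryRelease.dim X + ρ) *
                ((S.card : ℝ) ^ (3 / 8 : ℝ) * QueryRelease.dim X ^ (1 / 4 : ℝ) *
                  Real.sqrt (Real.log (Q.card / β)) /
                  (ρ ^ (1 / 4 : ℝ) * (n : ℝ) ^ (1 / 2 : ℝ)))) β ∧
            ∀ δ₀ δ ε : ℝ, 0 < δ → δ ≤ δ₀ → δ₀ < 1 →
              ε = ρ + 2 * Real.sqrt (ρ * Real.log (1 / δ)) → ε < 1 →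
              QueryRelease.AccurateWithProb (QueryRelease.sepFEM O Q S ρ T η s) Q D
                (C₂ δ₀ * QueryRelease.polylog k (n + S.card + QueryRelease.dim X) *
                  ((S.card : ℝ) ^ (3 / 8 : ℝ) * QueryRelease.dim X ^ (1 / 4 : ℝ) *
                    Real.sqrt (Real.log (Q.card / β) * Real.log (1 / δ)) /
                    (ε ^ (1 / 2 : ℝ) * (n : ℝ) ^ (1 / 2 : ℝ)))) β ∧
              ∀ c β₀ : ℝ, (S.card : ℝ) ≤ c * QueryRelease.dim X → β ≤ β₀ → β₀ < 1 →
                QueryRelease.AccurateWithProb (QueryRelease.sepFEM O Q S ρ T η s) Q D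
                  (C₃ c δ₀ β₀ * QueryRelease.polylog k (n + QueryRelease.dim X) *
                    (QueryRelease.dim X ^ (5 / 8 : ℝ) * Real.log Q.card ^ (1 / 2 : ℝ) *
                      Real.log (1 / δ) ^ (1 / 2 : ℝ) * Real.log (1 / β) ^ (1 / 2 : ℝ) /
                      (ε ^ (1 / 2 : ℝ) * (n : ℝ) ^ (1 / 2 : ℝ)))) β := by

  refine ⟨1, 44, QueryRelease.approxConst, QueryRelease.linearConst, ?_⟩
  intro X _ _ O Q _ S n ρ hQ hS hn hρ
  -- The oracle itself supplies a record.
  have hX : Nonempty X := ⟨O.pick 0⟩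
  refine ⟨fun T η s hT _ _ δ hδ hδ1 => QueryRelease.isDP_sepFEM O Q S hρ hT η s hδ hδ1,
    fun β hβ hβ1 => ?_⟩
  obtain ⟨T, η, s, hT, hη, hs, hacc⟩ := QueryRelease.exists_accurate O hQ hS hn hρ hβ hβ1
  refine ⟨T, η, s, hT, hη, hs, fun D => ⟨hacc D, fun δ₀ δ ε hδ hδδ hδ₀ hε hε1 => ?_⟩⟩
  have hd := QueryRelease.dim_nonneg (X := X)
  have h2 := (hacc D).mono (QueryRelease.approx_bound_le (Nat.cast_nonneg _) hd
    (Nat.cast_nonneg _) hρ hδ hδδ hδ₀ hε hε1)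
  refine ⟨h2, fun c β₀ hc hββ hβ₀ => h2.mono ?_⟩
  have hε0 : 0 < ε := by
    have := Real.sqrt_nonneg (ρ * Real.log (1 / δ))
    linarith
  have hl : 0 ≤ Real.log (1 / δ) :=
    Real.log_nonneg (by rw [le_div_iff₀ hδ]; linarith)
  exact QueryRelease.linear_bound_le (Nat.cast_nonneg _) QueryRelease.dim_eq_zero_or_one_le
    (Nat.cast_nonneg _) hl hε0 (by exact_mod_cast QueryRelease.two_le_card_of_negClosed hQ) hβ hc
    hββ hβ₀
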